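/- For a finite simple graph $G=(V,E)$ and $x\in[0,1)$ let $\mathcal{A}(G,x)$ be the set of real positive definite $V\times V$ matrices $M$ with $M_{v,v}=1$ for every vertex $v$ and $M_{u,v}=x$ for every edge $uv$ of $G$. There is a unique matrix $A_G(x)\in\mathcal{A}(G,x)$ of maximal determinant; put $\tau(G,x)=\det A_G(x)$. Let $e(G)$ be the number of edges, $\Delta$ the largest degree, $\overline{d}$ the average degree and $g\in\mathbb{N}\cup\{\infty\}$ the girth of $G$ (the length of a shortest cycle, and $\infty$ if $G$ has no cycle), and let $q^{\infty}=0$ for $0\le q<1$. (a) If $e(G)\ge 1$, $0\le x<1$ and $(\Delta-1)x<1$ (that is, $x\in[0,\frac{1}{\Delta-1})$ if $\Delta\ge 2$, and $x\in[0,1)$ if $\Delta=1$), then $$\left|\frac{\ln\tau(G,x)}{e(G)}-\ln(1-x^2)\right|\le 2\,\frac{((\Delta-1)x)^g}{1-(\Delta-1)x}.$$ (b) There is a function $\alpha$ of two real variables with $\alpha(d,x)>0$ whenever $d>1$ and $\frac{1}{d-1}<x<1$, such that for every finite simple graph $G$ with $\overline{d}>1$ and every $x$ with $\frac{1}{\overline{d}-1}<x<1$,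 $$\frac{\ln\tau(G,x)}{e(G)}-\ln(1-x^2)\ge\alpha(\overline{d},x).$$ -/

import Mathlib

namespace GMRF

/-- The set `𝒜(G, x)` of real positive definite (in particular symmetric) `V × V` matrices with
all diagonal entries `1` and with entry `x` at every edge of `G`. -/
def admissible {V : Type*} [Fintype V] (G : SimpleGraph V) (x : ℝ) : Set (Matrix V V ℝ) :=
  {M | M.PosDef ∧ (∀ v, M v v = 1) ∧ ∀ u v, G.Adj u v → M u v = x}

/-- `A` is an element of `𝒜(G, x)` of maximal determinant. -/
def IsDetMaximizer {V : Type*} [Fintype V] [DecidableEq V] (G : SimpleGraph V) (x : ℝ)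
    (A : Matrix V V ℝ) : Prop :=
  A ∈ admissible G x ∧ ∀ M ∈ admissible G x, M.det ≤ A.det

open Classical in
/-- The covariance matrix `A_G(x)`: the element of `𝒜(G, x)` of maximal determinant. It exists for
`0 ≤ x < 1`, see `covMatrix_isDetMaximizer` below; the value where there is none is irrelevant. -/
noncomputable def covMatrix {V : Type*} [Fintype V] [DecidableEq V] (G : SimpleGraph V) (x : ℝ) :
    Matrix V V ℝ :=
  if h : ∃ A, IsDetMaximizer G x A then h.choose else 0

/-- `τ(G, x) = det A_G(x)`. -/
noncomputable def tau {V : Type*} [Fintype V] [DecidableEq V] (G : SimpleGraph V) (x : ℝ) : ℝ :=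
  (covMatrix G x).det

/-- The average degree of a finite graph. -/
noncomputable def avgDegree {V : Type*} [Fintype V] (G : SimpleGraph V) [DecidableRel G.Adj] : ℝ :=
  (∑ v, (G.degree v : ℝ)) / Fintype.card V

/-- `q ^ g` for an exponent `g ∈ ℕ ∪ {∞}` and `0 ≤ q < 1`, with `q ^ ∞ = 0`
(a graph without cycles has girth `∞`). -/
noncomputable def girthPow (q : ℝ) (g : ℕ∞) : ℝ :=
  if g = ⊤ then 0 else q ^ g.toNat

/-- For `0 ≤ x < 1` the set `𝒜(G, x)` contains `(1 - x) I + x J`. -/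
theorem admissible_nonempty {V : Type*} [Fintype V] [DecidableEq V] (G : SimpleGraph V) {x : ℝ}
    (h0 : 0 ≤ x) (h1 : x < 1) : (admissible G x).Nonempty := by
  refine ⟨(1 - x) • (1 : Matrix V V ℝ) + x • Matrix.vecMulVec (fun _ => 1) (star fun _ => 1),
    ?_, ?_, ?_⟩
  · exact (Matrix.PosDef.one.smul (sub_pos.2 h1)).add_posSemidef
      ((Matrix.posSemidef_vecMulVec_self_star _).smul h0)
  · intro v
    simp [Matrix.vecMulVec_apply]
  · intro u v h
    simp [Matrix.vecMulVec_apply, h.ne]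

theorem abs_entry_le_one {V : Type*} [Fintype V] [DecidableEq V] {M : Matrix V V ℝ}
    (hM : M.PosSemidef) (hd : ∀ v, M v v = 1) (u v : V) : |M u v| ≤ 1 := by
  have hs : M v u = M u v := by simpa using hM.1.apply u v
  have key : ∀ c : ℝ, 0 ≤ 1 + 2 * c * M u v + c ^ 2 := by
    intro c
    have h := hM.dotProduct_mulVec_nonneg (Pi.single u 1 + Pi.single v c)
    simp [Matrix.mulVec_add, add_dotProduct, dotProduct_add, hd, hs] at h
    nlinarith
  have h1 := key 1
  have h2 := key (-1)
  rw [abs_le]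
  constructor <;> linarith

theorem exists_isDetMaximizer {V : Type*} [Fintype V] [DecidableEq V] (G : SimpleGraph V) {x : ℝ}
    (h0 : 0 ≤ x) (h1 : x < 1) : ∃ A, IsDetMaximizer G x A := by
  obtain ⟨M₀, hM₀⟩ := admissible_nonempty G h0 h1
  let K : Set (Matrix V V ℝ) :=
    {M | M.PosSemidef ∧ (∀ v, M v v = 1) ∧ ∀ u v, G.Adj u v → M u v = x}
  have hsub : admissible G x ⊆ K := fun M h => ⟨h.1.posSemidef, h.2⟩
  have hbox : IsCompact (Set.univ.pi fun _ : V => Set.univ.pi fun _ : V => Set.Icc (-1 : ℝ) 1) :=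
    isCompact_univ_pi fun _ => isCompact_univ_pi fun _ => isCompact_Icc
  have hent : ∀ u v : V, Continuous fun M : Matrix V V ℝ => M u v := fun u v =>
    continuous_id.matrix_elem u v
  have hclosed : IsClosed K := by
    have hK : K = {M | M.IsHermitian} ∩ (⋂ w : V → ℝ, {M | 0 ≤ star w ⬝ᵥ (M.mulVec w)}) ∩
        ((⋂ v, {M | M v v = 1}) ∩ ⋂ u, ⋂ v, ⋂ _ : G.Adj u v, {M | M u v = x}) := by
      ext M
      simp [K, Matrix.posSemidef_iff_dotProduct_mulVec]
    rw [hK]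
    refine (IsClosed.inter ?_ ?_).inter (IsClosed.inter ?_ ?_)
    · exact isClosed_eq continuous_id.matrix_conjTranspose continuous_id
    · exact isClosed_iInter fun w => isClosed_le continuous_const
        (continuous_const.dotProduct (continuous_id.matrix_mulVec continuous_const))
    · exact isClosed_iInter fun v => isClosed_eq (hent v v) continuous_const
    · exact isClosed_iInter fun u => isClosed_iInter fun v => isClosed_iInter fun _ =>
        isClosed_eq (hent u v) continuous_const
  have hcomp : IsCompact K := hbox.of_isClosed_subset hclosed fun M hM u _ v _ =>
    abs_le.1 (abs_entry_le_one hM.1 hM.2.1 u v)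
  obtain ⟨A, hA, hmax⟩ := hcomp.exists_isMaxOn ⟨M₀, hsub hM₀⟩
    (continuous_id.matrix_det (R := ℝ)).continuousOn
  have hdet : 0 < A.det := hM₀.1.det_pos.trans_le (hmax (hsub hM₀))
  refine ⟨A, ⟨?_, hA.2⟩, fun M hM => hmax (hsub hM)⟩
  exact (hA.1.posDef_iff_isUnit).2 ((Matrix.isUnit_iff_isUnit_det _).2 hdet.ne'.isUnit)

theorem covMatrix_isDetMaximizer {V : Type*} [Fintype V] [DecidableEq V] (G : SimpleGraph V)
    {x : ℝ} (h0 : 0 ≤ x) (h1 : x < 1) : IsDetMaximizer G x (covMatrix G x) := by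
  have h := exists_isDetMaximizer G h0 h1
  rw [covMatrix, dif_pos h]
  exact h.choose_spec

theorem tau_pos {V : Type*} [Fintype V] [DecidableEq V] (G : SimpleGraph V)
    {x : ℝ} (h0 : 0 ≤ x) (h1 : x < 1) : 0 < tau G x :=
  (covMatrix_isDetMaximizer G h0 h1).1.1.det_pos

end GMRF

/-! Both parts use the Sidorenko bound `τ(G, x) ≥ (1 - x²)^e(G)` (`card_mul_log_le_log_tau`).
Maximize the determinant under the extra constraint that off-diagonal entries are at most `x`; this
can only lower the maximum. The inverse of the optimal matrix is nonnegative at non-edges, and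
positive there only where the cap is attained. At edges it is at least `-x / (1 - x²)`, the value
for a single edge (`IsCappedPair.le_inv_apply`): vertices whose row sum in the inverse is positive
are marginalized until only the edge remains, and no step increases the entry in question. Since log
det is concave, the capped maximum then decays in `x` no faster than `(1 - x²)^e(G)`.

The upper bound in (a) is weak duality. The matrix `K = treeConcentration G x` lives on the diagonal
and the edges, and `tr (K A) = |V|` for every admissible `A`, hence `log τ ≤ -log det K`. By
Ihara-Bass, `det (1 - xB) = det (1 + xJ) det K`, where `B` is the nonbacktracking matrix, `J` is
dart reversal and `|det (1 + xJ)| = (1 - x²)^e(G)`. The error is thus at most `-log det (1 - xB)`.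
It is small because `tr B^k = 0` for `1 ≤ k < g` and the rows of `B` sum to at most `Δ - 1`.

For (b), a convex combination of `A_G(y)` and the all-ones matrix is admissible at `x > y`. Combined
with the Sidorenko bound at `y = 1 / (d - 1)`, it gives an explicit positive gap. -/

namespace GMRF
open Matrix Finset Filter Topology

/-! ### Concavity of log det -/

section LogDet
variable {V : Type*} [Fintype V] [DecidableEq V]

theorem log_det_le_trace_sub_card {P : Matrix V V ℝ} (hP : P.PosDef) :
    Real.log P.det ≤ P.trace - Fintype.card V := by
  have hd : P.det = ∏ i, hP.1.eigenvalues i := by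
    simpa using hP.1.det_eq_prod_eigenvalues
  have ht : P.trace = ∑ i, hP.1.eigenvalues i := by
    simpa using hP.1.trace_eq_sum_eigenvalues
  rw [hd, ht, Real.log_prod fun i _ => (hP.eigenvalues_pos i).ne']
  calc ∑ i, Real.log (hP.1.eigenvalues i)
      ≤ ∑ i, (hP.1.eigenvalues i - 1) :=
        sum_le_sum fun i _ => Real.log_le_sub_one_of_pos (hP.eigenvalues_pos i)
    _ = _ := by simp [sum_sub_distrib]

/-- Concavity of `log det`, in its tangent line form. -/
theorem log_det_add_log_det_le {K A : Matrix V V ℝ} (hK : K.PosDef) (hA : A.PosDef) :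
    Real.log K.det + Real.log A.det ≤ (K * A).trace - Fintype.card V := by
  obtain ⟨C, hC⟩ : ∃ C : Matrix V V ℝ, K = Cᴴ * C := by
    open scoped MatrixOrder in
    exact CStarAlgebra.nonneg_iff_eq_star_mul_self.1 hK.posSemidef.nonneg
  have hCdet : K.det = C.det * C.det := by rw [hC]; simp
  have hCne : C.det ≠ 0 := fun h => hK.det_pos.ne' (by rw [hCdet, h, zero_mul])
  have hCu : IsUnit C := (Matrix.isUnit_iff_isUnit_det _).2 hCne.isUnit
  -- `K * A` need not be symmetric; this matrix is, and has the same determinant and trace.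
  have hP : (C * A * Cᴴ).PosDef := hCu.posDef_star_right_conjugate_iff.2 hA
  have h := log_det_le_trace_sub_card hP
  have hdet : (C * A * Cᴴ).det = K.det * A.det := by
    rw [hCdet]; simp; ring
  have htr : (C * A * Cᴴ).trace = (K * A).trace := by
    rw [Matrix.trace_mul_comm, ← Matrix.mul_assoc, ← hC]
  rw [hdet, htr, Real.log_mul hK.det_pos.ne' hA.det_pos.ne'] at h
  exact h

theorem log_det_le_log_det_add {M K A : Matrix V V ℝ} (hM : M.PosDef) (hMK : M * K = 1)
    (hA : A.PosDef) :
    Real.log A.det ≤ Real.log M.det + ((K * A).trace - Fintype.card V) := by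
  have hK : K = M⁻¹ := (Matrix.inv_eq_right_inv hMK).symm
  have hKp : K.PosDef := hK ▸ hM.inv
  have h := log_det_add_log_det_le hKp hA
  have hd : M.det * K.det = 1 := by rw [← Matrix.det_mul, hMK, Matrix.det_one]
  have : Real.log M.det + Real.log K.det = 0 := by
    rw [← Real.log_mul hM.det_pos.ne' hKp.det_pos.ne', hd, Real.log_one]
  linarith
end LogDet

/-! ### Inverses of capped correlation matrices -/

section Capped
variable {V : Type*} [Fintype V] [DecidableEq V]

/-- `M` is a correlation matrix with off-diagonal entries at most `x`, and its inverse `K` is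
positive off the diagonal only where `M` attains the bound `x`. -/
structure IsCappedPair (x : ℝ) (M K : Matrix V V ℝ) : Prop where
  posDef : M.PosDef
  mul_eq_one : M * K = 1
  diag : ∀ v, M v v = 1
  le : ∀ u v, u ≠ v → M u v ≤ x
  eq_of_pos : ∀ u v, u ≠ v → 0 < K u v → M u v = x

namespace IsCappedPair
variable {x : ℝ} {M K : Matrix V V ℝ}

theorem inv_eq (h : IsCappedPair x M K) : M⁻¹ = K := Matrix.inv_eq_right_inv h.mul_eq_one

theorem inv_posDef (h : IsCappedPair x M K) : K.PosDef := h.inv_eq ▸ h.posDef.inv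

theorem symm (h : IsCappedPair x M K) (u v : V) : M v u = M u v := by
  simpa using h.posDef.1.apply u v

theorem inv_symm (h : IsCappedPair x M K) (u v : V) : K v u = K u v := by
  simpa using h.inv_posDef.1.apply u v

theorem mulVec_col (h : IsCappedPair x M K) (i : V) :
    M *ᵥ (fun j => K j i) = Pi.single i 1 := by
  have : (fun j => K j i) = K *ᵥ Pi.single i 1 := by ext j; simp
  rw [this, Matrix.mulVec_mulVec, h.mul_eq_one, Matrix.one_mulVec]

theorem dotProduct_mulVec_comm (h : IsCappedPair x M K) (f g : V → ℝ) :
    f ⬝ᵥ M *ᵥ g = g ⬝ᵥ M *ᵥ f := by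
  have : Mᵀ = M := by ext u v; exact h.symm u v
  rw [Matrix.dotProduct_mulVec, ← Matrix.mulVec_transpose, this, dotProduct_comm]

/-- If the row sum of `K` at `i` is nonnegative, then the off-diagonal entries in that row are
nonpositive. -/
theorem inv_apply_nonpos (h : IsCappedPair x M K) (h0 : 0 ≤ x) {i : V}
    (hκ : 0 ≤ ∑ j, K j i) {w : V} (hw : w ≠ i) : K w i ≤ 0 := by
  by_contra! hpos
  set r : V → ℝ := fun j => K j i with hr
  set a := K i i with ha
  have ha0 : 0 < a := h.inv_posDef.diag_pos
  set e : V → ℝ := Pi.single i 1 with he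
  set p : V → ℝ := fun j => if j = i then 0 else max (K j i) 0 with hp
  set ν : V → ℝ := fun j => if j = i then 0 else max (-K j i) 0 with hν
  have hp0 : ∀ j, 0 ≤ p j := fun j => by simp only [hp]; split_ifs <;> simp
  have hν0 : ∀ j, 0 ≤ ν j := fun j => by simp only [hν]; split_ifs <;> simp
  have hpi : p i = 0 := by simp [hp]
  have hνi : ν i = 0 := by simp [hν]
  have hpw : p w = K w i := by simp [hp, hw, hpos.le]
  have hpne : ∀ j, p j ≠ 0 → j ≠ i ∧ 0 < K j i := by
    intro j hj
    by_cases hji : j = i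
    · simp [hp, hji] at hj
    · refine ⟨hji, ?_⟩
      by_contra! hc
      simp [hp, hji, hc] at hj
  have hrdec : r = a • e + p - ν := by
    ext j
    by_cases hji : j = i
    · simp [hr, he, hp, hν, hji, ha]
    · have := max_zero_sub_eq_self (K j i)
      simp only [hr, he, hp, hν, hji, Pi.add_apply, Pi.sub_apply, Pi.smul_apply, ne_eq,
        not_false_eq_true, Pi.single_eq_of_ne, smul_zero, zero_add, if_false]
      rcases le_total 0 (K j i) with hc | hc
      · simp [hc]
      · simp [hc]
  -- Column `i` of `K` is `a e + p - ν`, with `p` and `ν` its off-diagonal positive and negative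
  -- parts. The row sum hypothesis becomes `U ≤ a + Z`.
  set Z := ∑ j, p j with hZ
  set U := ∑ j, ν j with hU
  have hUZ : U ≤ a + Z := by
    have : ∑ j, r j = a + Z - U := by
      rw [hrdec]; simp [sum_add_distrib, sum_sub_distrib, he, hZ, hU, ← mul_sum]
    linarith
  have hZw : p w ≤ Z := single_le_sum (fun j _ => hp0 j) (mem_univ w)
  have hMr : M *ᵥ r = e := h.mulVec_col i
  have hpe : p ⬝ᵥ M *ᵥ e = x * Z := by
    simp only [dotProduct, he, Matrix.mulVec_single_one, Matrix.col_apply, hZ, mul_sum]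
    refine sum_congr rfl fun j _ => ?_
    by_cases hj : p j = 0
    · simp [hj]
    · rw [h.eq_of_pos j i (hpne j hj).1 (hpne j hj).2, mul_comm]
  have hpr : p ⬝ᵥ M *ᵥ r = 0 := by rw [hMr]; simp [he, hpi]
  have her : e ⬝ᵥ M *ᵥ r = 1 := by rw [hMr]; simp [he]
  have hrr : r ⬝ᵥ M *ᵥ r = a := by rw [hMr]; simp [he, hr, ha]
  have hee : e ⬝ᵥ M *ᵥ e = 1 := by simp [he, h.diag]
  have hpν : p ⬝ᵥ M *ᵥ ν ≤ x * Z * U := by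
    have : x * Z * U = ∑ j, p j * ∑ l, x * ν l := by
      rw [← mul_sum, ← sum_mul, ← hZ, ← hU]; ring
    rw [this]
    simp only [dotProduct, Matrix.mulVec]
    refine sum_le_sum fun j _ => ?_
    simp only [mul_sum]
    refine sum_le_sum fun l _ => ?_
    by_cases hjl : j = l
    · have hz : p j * ν l = 0 := by
        subst hjl
        by_cases hji : j = i
        · simp [hp, hji]
        · rcases le_total 0 (K j i) with hc | hc
          · simp [hν, hji, hc]
          · simp [hp, hji, hc]
      rw [mul_left_comm, hz, mul_left_comm, hz]; simp
    · exact mul_le_mul_of_nonneg_left (mul_le_mul_of_nonneg_right (h.le j l hjl) (hν0 l)) (hp0 j)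
  have heν : e ⬝ᵥ M *ᵥ ν ≤ x * U := by
    rw [he, single_one_dotProduct, hU, mul_sum]
    simp only [Matrix.mulVec, dotProduct]
    refine sum_le_sum fun l _ => ?_
    by_cases hl : l = i
    · simp [hl, hνi]
    · exact mul_le_mul_of_nonneg_right (h.le i l (Ne.symm hl)) (hν0 l)
  have hexp : ∀ f : V → ℝ, f ⬝ᵥ M *ᵥ r = a * (f ⬝ᵥ M *ᵥ e) + f ⬝ᵥ M *ᵥ p - f ⬝ᵥ M *ᵥ ν := by
    intro f
    rw [hrdec]
    simp [Matrix.mulVec_add, Matrix.mulVec_sub, Matrix.mulVec_smul]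
  have h1 := hexp p
  have h2 := hexp e
  have hep := h.dotProduct_mulVec_comm e p
  have hrp := h.dotProduct_mulVec_comm r p
  have hre := h.dotProduct_mulVec_comm r e
  have hZ0 : 0 < Z := by linarith
  have hpp : p ⬝ᵥ M *ᵥ p ≤ x * Z ^ 2 := by
    nlinarith [mul_le_mul_of_nonneg_left hUZ (mul_nonneg h0 hZ0.le)]
  have ha1 : a * (1 - x) ≤ 1 := by
    nlinarith [mul_le_mul_of_nonneg_left hUZ h0]
  -- In the inner product of `M`, `p` is orthogonal to `r`, and `e - r / a` is the part of `e`
  -- orthogonal to `r`. The vector `q` is `a Z` times the difference of `p / Z` and `e - r / a`,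
  -- whose squared norm is at most `x - 2x + (1 - 1 / a) = 1 - x - 1 / a ≤ 0`.
  set q : V → ℝ := a • p - (a * Z) • e + Z • r with hq
  have hqq : q ⬝ᵥ M *ᵥ q = a ^ 2 * (p ⬝ᵥ M *ᵥ p) + Z ^ 2 * (a ^ 2 * (1 - 2 * x) - a) := by
    simp only [hq, Matrix.mulVec_add, Matrix.mulVec_sub, Matrix.mulVec_smul, dotProduct_add,
      dotProduct_sub, add_dotProduct, sub_dotProduct, smul_dotProduct, dotProduct_smul,
      smul_eq_mul, hep, hrp, hre, hpe, hpr, her, hrr, hee]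
    ring
  have hqw : q w ≠ 0 := by
    have : q w = (a + Z) * K w i := by
      simp [hq, he, hw, hpw, hr]; ring
    rw [this]; positivity
  have hqpos := h.posDef.dotProduct_mulVec_pos (x := q) (fun hc => hqw (by rw [hc]; rfl))
  rw [star_trivial, hqq] at hqpos
  have : a ^ 2 * (p ⬝ᵥ M *ᵥ p) ≤ a ^ 2 * (x * Z ^ 2) := by gcongr
  nlinarith [mul_le_mul_of_nonneg_left ha1 (by positivity : 0 ≤ a * Z ^ 2)]

/-- The test vector `y = 1 - (M e_u + M e_v) / (1 + x)` vanishes at `u` and `v` and is positive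
elsewhere, as entries are at most `x < (1 + x) / 2`. Away from `u` and `v`, `K y` is the vector of
row sums of `K`. Were these all nonpositive, `y ⬝ K y` would be too. -/
theorem exists_sum_pos (h : IsCappedPair x M K) (h0 : 0 ≤ x) (h1 : x < 1) {u v : V}
    (hM : M u v = x) {w : V} (hwu : w ≠ u) (hwv : w ≠ v) :
    ∃ r, r ≠ u ∧ r ≠ v ∧ 0 < ∑ j, K j r := by
  by_contra! hc
  have hx : 0 < 1 + x := by linarith
  set y : V → ℝ := fun j => 1 - (M j u + M j v) / (1 + x) with hy
  have hyu : y u = 0 := by simp [hy, h.diag, hM, hx.ne']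
  have hyv : y v = 0 := by
    simp only [hy, h.diag, h.symm u v, hM, add_comm x 1, div_self hx.ne', sub_self]
  have hypos : ∀ r, r ≠ u → r ≠ v → 0 < y r := by
    intro r hru hrv
    have := h.le r u hru
    have := h.le r v hrv
    simp only [hy, sub_pos]
    rw [div_lt_one hx]
    linarith
  have hKM : K * M = 1 := _root_.mul_eq_one_comm.1 h.mul_eq_one
  have hKy : ∀ j, (K *ᵥ y) j = (∑ l, K l j) -
      ((1 : Matrix V V ℝ) j u + (1 : Matrix V V ℝ) j v) / (1 + x) := by
    intro j
    rw [← hKM, Matrix.mul_apply, Matrix.mul_apply, ← sum_add_distrib, sum_div, ← sum_sub_distrib]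
    simp only [Matrix.mulVec, dotProduct]
    refine sum_congr rfl fun l _ => ?_
    rw [h.inv_symm j l, hy]; ring
  have hpos := h.inv_posDef.dotProduct_mulVec_pos (x := y)
    (fun hc => (hypos w hwu hwv).ne' (by rw [hc]; rfl))
  rw [star_trivial] at hpos
  refine hpos.not_ge (sum_nonpos fun j _ => ?_)
  by_cases hju : j = u
  · simp [hju, hyu]
  by_cases hjv : j = v
  · simp [hjv, hyv]
  rw [hKy]
  have := hc j hju hjv
  simp only [ne_eq, hju, not_false_eq_true, Matrix.one_apply_ne, hjv, add_zero, zero_div, sub_zero]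
  exact mul_nonpos_of_nonneg_of_nonpos (hypos j hju hjv).le this

/-- Marginalizing a variable with nonnegative row sum. -/
theorem erase (h : IsCappedPair x M K) {r : V} (hr : ∀ j, j ≠ r → K j r ≤ 0) :
    IsCappedPair (V := {w // w ≠ r}) x (M.submatrix (↑) (↑))
      (.of fun i j => K i j - K i r * K r j / K r r) where
  posDef := h.posDef.submatrix Subtype.val_injective
  mul_eq_one := by
    have hrr : K r r ≠ 0 := h.inv_posDef.diag_pos.ne'
    ext i l
    rw [Matrix.mul_apply]
    simp only [Matrix.submatrix_apply, Matrix.of_apply]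
    have hs : ∑ j : {w // w ≠ r}, M i j * (K j l - K j r * K r l / K r r) =
        ∑ j, M i j * (K j l - K j r * K r l / K r r) := by
      rw [Fintype.sum_eq_add_sum_subtype_ne _ r]
      have : K r l - K r r * K r l / K r r = 0 := by field_simp; ring
      rw [this, mul_zero, zero_add]
    have hs2 : ∑ j, M i j * (K j l - K j r * K r l / K r r) =
        (M * K) i l - (M * K) i r * K r l / K r r := by
      simp only [Matrix.mul_apply, sum_mul, sum_div, ← sum_sub_distrib]
      exact sum_congr rfl fun j _ => by ring
    rw [hs, hs2, h.mul_eq_one, Matrix.one_apply_ne i.2]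
    simp [Matrix.one_apply, Subtype.ext_iff]
  diag v := h.diag v
  le u v huv := h.le u v (Subtype.coe_ne_coe.2 huv)
  -- The Schur complement subtracts a nonnegative quantity off the diagonal, so a positive entry
  -- comes from a positive entry of `K`.
  eq_of_pos u v huv hpos := by
    refine h.eq_of_pos u v (Subtype.coe_ne_coe.2 huv) (lt_of_lt_of_le hpos ?_)
    simp only [Matrix.of_apply, sub_le_self_iff]
    have h1 := hr u u.2
    have h2 := hr v v.2
    rw [h.inv_symm r v] at h2
    exact div_nonneg (mul_nonneg_of_nonpos_of_nonpos h1 h2) h.inv_posDef.diag_pos.le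

end IsCappedPair
end Capped

/-- Induction on the number of vertices. Marginalizing a third vertex of positive row sum only
decreases the entry of `K` at `(u, v)`, so a bound afterwards is a bound before. With two vertices
left, the entry equals `-x / (1 - x²)`. -/
theorem IsCappedPair.le_inv_apply {x : ℝ} (h0 : 0 ≤ x) (h1 : x < 1) {V : Type*} [Fintype V]
    [DecidableEq V] {M K : Matrix V V ℝ} (h : IsCappedPair x M K) {u v : V} (huv : u ≠ v)
    (hM : M u v = x) : -(x / (1 - x ^ 2)) ≤ K u v := by
  induction hn : Fintype.card V using Nat.strong_induction_on generalizing V with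
  | _ n ih =>
  by_cases hw : ∃ w, w ≠ u ∧ w ≠ v
  · obtain ⟨w, hwu, hwv⟩ := hw
    obtain ⟨r, hru, hrv, hr⟩ := h.exists_sum_pos h0 h1 hM hwu hwv
    have hneg : ∀ j, j ≠ r → K j r ≤ 0 := fun j hj => h.inv_apply_nonpos h0 hr.le hj
    have key := ih (Fintype.card {w // w ≠ r})
      (by rw [← hn]; exact Fintype.card_subtype_lt (x := r) (by simp))
      (h.erase hneg) (u := ⟨u, hru.symm⟩) (v := ⟨v, hrv.symm⟩) (by simpa using huv) hM rfl
    refine key.trans ?_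
    simp only [Matrix.of_apply, sub_le_self_iff]
    have h2 := hneg v hrv.symm
    rw [h.inv_symm r v] at h2
    exact div_nonneg (mul_nonneg_of_nonpos_of_nonpos (hneg u hru.symm) h2)
      h.inv_posDef.diag_pos.le
  · push Not at hw
    have huniv : (univ : Finset V) = {u, v} := by
      ext w
      by_cases hwu : w = u <;> simp [hwu]
      exact hw w hwu
    have hmul : ∀ i j, M i u * K u j + M i v * K v j = (1 : Matrix V V ℝ) i j := by
      intro i j
      rw [← h.mul_eq_one, Matrix.mul_apply, huniv, sum_pair huv]
    have e1 := hmul u v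
    have e2 := hmul v v
    rw [Matrix.one_apply_ne huv, h.diag, hM] at e1
    rw [Matrix.one_apply_eq, h.diag, h.symm u v, hM] at e2
    have hx : 0 < 1 - x ^ 2 := by nlinarith
    rw [neg_le_iff_add_nonneg, add_div' _ _ _ hx.ne']
    apply div_nonneg _ hx.le
    have : K u v = - x * K v v := by linarith
    have h3 : K v v * (1 - x ^ 2) = 1 := by rw [this] at e2; linarith
    rw [this]; nlinarith

/-! ### The capped determinant problem and its optimality conditions -/

section CappedProblem
variable {V : Type*} [Fintype V] [DecidableEq V]

/-- The elements of `𝒜(G, x)` all of whose off-diagonal entries are at most `x`. -/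
def cappedAdmissible (G : SimpleGraph V) (x : ℝ) : Set (Matrix V V ℝ) :=
  {M | M ∈ admissible G x ∧ ∀ u v, u ≠ v → M u v ≤ x}

theorem cappedAdmissible_nonempty (G : SimpleGraph V) {x : ℝ} (h0 : 0 ≤ x) (h1 : x < 1) :
    (cappedAdmissible G x).Nonempty := by
  refine ⟨(1 - x) • (1 : Matrix V V ℝ) + x • Matrix.vecMulVec (fun _ => 1) (star fun _ => 1),
    ⟨?_, ?_, ?_⟩, ?_⟩
  · exact (Matrix.PosDef.one.smul (sub_pos.2 h1)).add_posSemidef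
      ((Matrix.posSemidef_vecMulVec_self_star _).smul h0)
  · intro v
    simp [Matrix.vecMulVec_apply]
  · intro u v h
    simp [Matrix.vecMulVec_apply, h.ne]
  · intro u v h
    simp [Matrix.vecMulVec_apply, h]

theorem exists_isMaxOn_cappedAdmissible (G : SimpleGraph V) {x : ℝ} (h0 : 0 ≤ x) (h1 : x < 1) :
    ∃ A ∈ cappedAdmissible G x, ∀ M ∈ cappedAdmissible G x, M.det ≤ A.det := by
  obtain ⟨M₀, hM₀⟩ := cappedAdmissible_nonempty G h0 h1
  let K : Set (Matrix V V ℝ) :=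
    {M | M.PosSemidef ∧ (∀ v, M v v = 1) ∧ (∀ u v, G.Adj u v → M u v = x) ∧
      ∀ u v, u ≠ v → M u v ≤ x}
  have hsub : cappedAdmissible G x ⊆ K := fun M h => ⟨h.1.1.posSemidef, h.1.2.1, h.1.2.2, h.2⟩
  have hbox : IsCompact (Set.univ.pi fun _ : V => Set.univ.pi fun _ : V => Set.Icc (-1 : ℝ) 1) :=
    isCompact_univ_pi fun _ => isCompact_univ_pi fun _ => isCompact_Icc
  have hent : ∀ u v : V, Continuous fun M : Matrix V V ℝ => M u v := fun u v =>
    continuous_id.matrix_elem u v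
  have hclosed : IsClosed K := by
    have hK : K = {M | M.IsHermitian} ∩ (⋂ w : V → ℝ, {M | 0 ≤ star w ⬝ᵥ (M.mulVec w)}) ∩
        ((⋂ v, {M | M v v = 1}) ∩ ((⋂ u, ⋂ v, ⋂ _ : G.Adj u v, {M | M u v = x}) ∩
          ⋂ u, ⋂ v, ⋂ _ : u ≠ v, {M | M u v ≤ x})) := by
      ext M
      simp [K, Matrix.posSemidef_iff_dotProduct_mulVec]
    rw [hK]
    refine (IsClosed.inter ?_ ?_).inter (IsClosed.inter ?_ (IsClosed.inter ?_ ?_))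
    · exact isClosed_eq continuous_id.matrix_conjTranspose continuous_id
    · exact isClosed_iInter fun w => isClosed_le continuous_const
        (continuous_const.dotProduct (continuous_id.matrix_mulVec continuous_const))
    · exact isClosed_iInter fun v => isClosed_eq (hent v v) continuous_const
    · exact isClosed_iInter fun u => isClosed_iInter fun v => isClosed_iInter fun _ =>
        isClosed_eq (hent u v) continuous_const
    · exact isClosed_iInter fun u => isClosed_iInter fun v => isClosed_iInter fun _ =>
        isClosed_le (hent u v) continuous_const
  have hcomp : IsCompact K := hbox.of_isClosed_subset hclosed fun M hM u _ v _ =>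
    abs_le.1 (abs_entry_le_one hM.1 hM.2.1 u v)
  obtain ⟨A, hA, hmax⟩ := hcomp.exists_isMaxOn ⟨M₀, hsub hM₀⟩
    (continuous_id.matrix_det (R := ℝ)).continuousOn
  have hdet : 0 < A.det := hM₀.1.1.det_pos.trans_le (hmax (hsub hM₀))
  refine ⟨A, ⟨⟨?_, hA.2.1, hA.2.2.1⟩, hA.2.2.2⟩, fun M hM => hmax (hsub hM)⟩
  exact (hA.1.posDef_iff_isUnit).2 ((Matrix.isUnit_iff_isUnit_det _).2 hdet.ne'.isUnit)

/-- Cauchy-Schwarz in the inner product of `M`, for `f` and `M⁻¹ e_u`. -/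
theorem sq_le_inv_mul_dotProduct_mulVec {M : Matrix V V ℝ} (hM : M.PosDef) (f : V → ℝ) (u : V) :
    f u ^ 2 ≤ M⁻¹ u u * (f ⬝ᵥ M *ᵥ f) := by
  set K := M⁻¹ with hK
  have hKp : K.PosDef := hM.inv
  have hMK : M * K = 1 := Matrix.mul_nonsing_inv _ ((Matrix.isUnit_iff_isUnit_det _).1 hM.isUnit)
  have hMt : Mᵀ = M := hM.1
  set g : V → ℝ := K *ᵥ Pi.single u 1 with hg
  have hMg : M *ᵥ g = Pi.single u 1 := by
    rw [hg, Matrix.mulVec_mulVec, hMK, Matrix.one_mulVec]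
  have hgf : g ⬝ᵥ M *ᵥ f = f u := by
    rw [Matrix.dotProduct_mulVec, ← Matrix.mulVec_transpose, hMt, hMg]; simp
  have h := hM.posSemidef.dotProduct_mulVec_nonneg (K u u • f - f u • g)
  simp only [star_trivial, Matrix.mulVec_sub, Matrix.mulVec_smul, sub_dotProduct, dotProduct_sub,
    smul_dotProduct, dotProduct_smul, hgf, smul_eq_mul, hMg] at h
  simp [hg] at h
  have hpos : 0 < K u u := hKp.diag_pos
  nlinarith

theorem posDef_add_smul_single {M : Matrix V V ℝ} (hM : M.PosDef) (u v : V) {t : ℝ}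
    (ht : |t| * (M⁻¹ u u + M⁻¹ v v) < 1) :
    (M + t • (Matrix.single u v 1 + Matrix.single v u 1)).PosDef := by
  refine .of_dotProduct_mulVec_pos ?_ fun f hf => ?_
  · refine hM.1.add ?_
    ext i j
    simp only [Matrix.conjTranspose_apply, Matrix.smul_apply, Matrix.add_apply,
      Matrix.single_apply, star_trivial, and_comm, add_comm]
  · have hpos := hM.dotProduct_mulVec_pos hf
    have h1 := sq_le_inv_mul_dotProduct_mulVec hM f u
    have h2 := sq_le_inv_mul_dotProduct_mulVec hM f v
    simp only [star_trivial] at hpos ⊢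
    have hE : f ⬝ᵥ (M + t • (Matrix.single u v 1 + Matrix.single v u 1)) *ᵥ f =
        f ⬝ᵥ M *ᵥ f + t * (2 * (f u * f v)) := by
      rw [Matrix.add_mulVec, Matrix.smul_mulVec, dotProduct_add, dotProduct_smul, Matrix.add_mulVec,
        dotProduct_add, Matrix.single_mulVec, Matrix.single_mulVec]
      simp only [one_mul, ← Pi.single.eq_1, dotProduct_single, smul_eq_mul]
      ring
    rw [hE]
    have h3 : |2 * (f u * f v)| ≤ (M⁻¹ u u + M⁻¹ v v) * (f ⬝ᵥ M *ᵥ f) := by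
      rw [abs_le]; constructor <;> nlinarith [sq_nonneg (f u + f v), sq_nonneg (f u - f v)]
    have h4 : |t * (2 * (f u * f v))| < f ⬝ᵥ M *ᵥ f := by
      rw [abs_mul]
      calc _ ≤ |t| * ((M⁻¹ u u + M⁻¹ v v) * (f ⬝ᵥ M *ᵥ f)) := by gcongr
        _ = (|t| * (M⁻¹ u u + M⁻¹ v v)) * (f ⬝ᵥ M *ᵥ f) := by ring
        _ < 1 * (f ⬝ᵥ M *ᵥ f) := by gcongr
        _ = _ := one_mul _
    linarith [neg_abs_le (t * (2 * (f u * f v)))]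

/-- First order optimality. -/
theorem mul_inv_apply_nonpos {M : Matrix V V ℝ} (hM : M.PosDef) {u v : V} (s : ℝ)
    (h : ∀ᶠ t in 𝓝[>] (0 : ℝ),
      (M + (t * s) • (Matrix.single u v 1 + Matrix.single v u 1)).det ≤ M.det) :
    s * M⁻¹ u v ≤ 0 := by
  set E : Matrix V V ℝ := Matrix.single u v 1 + Matrix.single v u 1 with hE
  have hMK : M * M⁻¹ = 1 :=
    Matrix.mul_nonsing_inv _ ((Matrix.isUnit_iff_isUnit_det _).1 hM.isUnit)
  have hs : M⁻¹ v u = M⁻¹ u v := by simpa using hM.inv.1.apply u v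
  have htr : (M⁻¹ * E).trace = 2 * M⁻¹ u v := by
    rw [hE, Matrix.mul_add, Matrix.trace_add, Matrix.trace_mul_single, Matrix.trace_mul_single]
    simp [hs]; ring
  obtain ⟨p, hp⟩ : ∃ p : Polynomial ℝ, ∀ r : ℝ,
      (1 + r • (s • (M⁻¹ * E))).det = 1 + (s • (M⁻¹ * E)).trace * r + p.eval r * r ^ 2 :=
    ⟨_, fun r => Matrix.det_one_add_smul r _⟩
  have hcont : Tendsto (fun t => s * (2 * M⁻¹ u v) + p.eval t * t) (𝓝[>] 0)
      (𝓝 (s * (2 * M⁻¹ u v) + p.eval 0 * 0)) :=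
    Continuous.tendsto (by fun_prop) 0 |>.mono_left nhdsWithin_le_nhds
  have hle : ∀ᶠ t in 𝓝[>] (0 : ℝ), s * (2 * M⁻¹ u v) + p.eval t * t ≤ 0 := by
    filter_upwards [h, self_mem_nhdsWithin] with t ht (ht0 : 0 < t)
    have hfac : M + (t * s) • E = M * (1 + t • (s • (M⁻¹ * E))) := by
      rw [Matrix.mul_add, Matrix.mul_smul, Matrix.mul_smul, ← Matrix.mul_assoc, hMK]
      simp [smul_smul]
    rw [hfac, Matrix.det_mul, hp, Matrix.trace_smul, htr] at ht
    have := (mul_le_iff_le_one_right hM.det_pos).1 ht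
    simp only [smul_eq_mul] at this
    have : (s * (2 * M⁻¹ u v) + p.eval t * t) * t ≤ 0 := by linarith
    exact nonpos_of_mul_nonpos_left this ht0
  have := le_of_tendsto hcont hle
  linarith

/-- Karush-Kuhn-Tucker conditions: a non-edge entry may always be lowered, and may be raised if it
is below the cap. -/
theorem isCappedPair_of_forall_det_le {G : SimpleGraph V} {x : ℝ} {A : Matrix V V ℝ}
    (hA : A ∈ cappedAdmissible G x) (hmax : ∀ M ∈ cappedAdmissible G x, M.det ≤ A.det) :
    IsCappedPair x A A⁻¹ ∧ ∀ u v, u ≠ v → ¬ G.Adj u v → 0 ≤ A⁻¹ u v := by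
  obtain ⟨⟨hpd, hdiag, hadj⟩, hcap⟩ := hA
  have key : ∀ u v : V, u ≠ v → ¬ G.Adj u v → ∀ s : ℝ,
      (∀ᶠ t in 𝓝[>] (0 : ℝ), A u v + t * s ≤ x) → s * A⁻¹ u v ≤ 0 := by
    intro u v huv hnadj s hev
    refine mul_inv_apply_nonpos hpd s ?_
    have hsmall : ∀ᶠ t in 𝓝[>] (0 : ℝ), |t * s| * (A⁻¹ u u + A⁻¹ v v) < 1 := by
      have : Tendsto (fun t : ℝ => |t * s| * (A⁻¹ u u + A⁻¹ v v)) (𝓝[>] 0)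
          (𝓝 (|0 * s| * (A⁻¹ u u + A⁻¹ v v))) :=
        Continuous.tendsto (by fun_prop) 0 |>.mono_left nhdsWithin_le_nhds
      refine this.eventually_lt_const (by simp)
    have hsy : A v u = A u v := by simpa using hpd.1.apply u v
    filter_upwards [hev, hsmall] with t ht1 ht2
    refine hmax _ ⟨⟨posDef_add_smul_single hpd u v ht2, fun w => ?_, fun i j hij => ?_⟩,
      fun i j hij => ?_⟩
    · have h1 : ¬ (u = w ∧ v = w) := fun h => huv (h.1.trans h.2.symm)
      have h2 : ¬ (v = w ∧ u = w) := fun h => huv (h.2.trans h.1.symm)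
      simp [h1, h2, hdiag]
    · have h1 : ¬ (u = i ∧ v = j) := fun h => hnadj (by rw [h.1, h.2]; exact hij)
      have h2 : ¬ (v = i ∧ u = j) := fun h => hnadj (by rw [h.1, h.2]; exact hij.symm)
      simp [h1, h2, hadj i j hij]
    · by_cases h1 : u = i ∧ v = j
      · obtain ⟨rfl, rfl⟩ := h1
        simpa [Matrix.single_apply, huv, huv.symm] using ht1
      · by_cases h2 : v = i ∧ u = j
        · obtain ⟨rfl, rfl⟩ := h2
          simpa [Matrix.single_apply, huv, huv.symm, hsy] using ht1
        · simpa [Matrix.single_apply, h1, h2] using hcap i j hij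
  have hnn : ∀ u v, u ≠ v → ¬ G.Adj u v → 0 ≤ A⁻¹ u v := by
    intro u v huv hnadj
    have := key u v huv hnadj (-1) (by
      filter_upwards [self_mem_nhdsWithin] with t (ht : 0 < t)
      linarith [hcap u v huv])
    linarith
  refine ⟨⟨hpd, Matrix.mul_nonsing_inv _ ((Matrix.isUnit_iff_isUnit_det _).1 hpd.isUnit), hdiag,
    hcap, fun u v huv hpos => ?_⟩, hnn⟩
  by_contra hne
  have hlt : A u v < x := lt_of_le_of_ne (hcap u v huv) hne
  have := key u v huv (fun h => hne (hadj u v h)) 1 (by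
    have : Tendsto (fun t : ℝ => A u v + t * 1) (𝓝[>] 0) (𝓝 (A u v + 0 * 1)) :=
      Continuous.tendsto (by fun_prop) 0 |>.mono_left nhdsWithin_le_nhds
    exact (this.eventually_lt_const (by simpa using hlt)).mono fun t => le_of_lt)
  linarith

/-- In `tr (A⁻¹ (B - A))` the diagonal contributes nothing and each edge is controlled by
`le_inv_apply`. At a non-edge with `A⁻¹` positive, `A` equals `x` while `B` is at most `y ≤ x`, so
the term is nonpositive. -/
theorem trace_mul_sub_le {G : SimpleGraph V} [DecidableRel G.Adj] {x y : ℝ} (h0 : 0 ≤ x)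
    (h1 : x < 1) (hyx : y ≤ x) {A B : Matrix V V ℝ}
    (hA : A ∈ cappedAdmissible G x) (hmax : ∀ M ∈ cappedAdmissible G x, M.det ≤ A.det)
    (hB : B ∈ cappedAdmissible G y) :
    (A⁻¹ * B).trace - Fintype.card V ≤ 2 * (x - y) * G.edgeFinset.card * (x / (1 - x ^ 2)) := by
  obtain ⟨hP, hnn⟩ := isCappedPair_of_forall_det_le hA hmax
  have hcard : (Fintype.card V : ℝ) = (A⁻¹ * A).trace := by
    rw [Matrix.nonsing_inv_mul _ ((Matrix.isUnit_iff_isUnit_det _).1 hP.posDef.isUnit)]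
    simp
  have hdeg : (2 * (x - y) * G.edgeFinset.card * (x / (1 - x ^ 2)) : ℝ) =
      ∑ i, ∑ j, if G.Adj i j then (x - y) * (x / (1 - x ^ 2)) else 0 := by
    have := G.sum_degrees_eq_twice_card_edges
    have h2 : ∑ i, (G.degree i : ℝ) = 2 * G.edgeFinset.card := by exact_mod_cast this
    simp_rw [← sum_filter, sum_const, ← SimpleGraph.neighborFinset_eq_filter,
      SimpleGraph.card_neighborFinset_eq_degree, nsmul_eq_mul, ← sum_mul, h2]
    ring
  rw [hcard, hdeg, ← Matrix.trace_sub, ← Matrix.mul_sub]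
  simp only [Matrix.trace, Matrix.diag, Matrix.mul_apply, Matrix.sub_apply]
  refine sum_le_sum fun i _ => sum_le_sum fun j _ => ?_
  split_ifs with hij
  · rw [hA.1.2.2 j i hij.symm, hB.1.2.2 j i hij.symm]
    have := hP.le_inv_apply h0 h1 hij.ne (hA.1.2.2 i j hij)
    nlinarith
  · by_cases hne : i = j
    · subst hne
      simp [hA.1.2.1, hB.1.2.1]
    · rcases (hnn i j hne hij).eq_or_lt with hz | hpos
      · simp [← hz]
      · have e1 := hP.eq_of_pos i j hne hpos
        rw [hP.symm i j, e1]
        have e2 := hB.2 j i (Ne.symm hne)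
        nlinarith

end CappedProblem

/-! ### The Sidorenko bound -/

/-- Over `N` equal steps the total loss is `C X² / N`, which tends to `0`. No regularity of `φ` is
needed, so the capped maximum need not be differentiated in `x`. -/
theorem le_of_quadratic_defect {φ : ℝ → ℝ} {X C : ℝ} (hX : 0 ≤ X)
    (h : ∀ y x, 0 ≤ y → y ≤ x → x ≤ X → φ y - C * (x - y) ^ 2 ≤ φ x) : φ 0 ≤ φ X := by
  have hstep : ∀ N : ℕ, 0 < N → ∀ k : ℕ, k ≤ N →
      φ 0 - k * (C * (X / N) ^ 2) ≤ φ (X * k / N) := by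
    intro N hN k
    have hN' : (0 : ℝ) < N := by exact_mod_cast hN
    induction k with
    | zero => simp
    | succ k ih =>
      intro hk
      have hk' : ((k : ℝ) + 1) ≤ N := by exact_mod_cast hk
      have h1 := ih (by omega)
      have h2 := h (X * k / N) (X * (k + 1 : ℕ) / N) (by positivity) (by gcongr; simp)
        (by rw [div_le_iff₀ hN']; push_cast; gcongr)
      have h3 : X * (k + 1 : ℕ) / N - X * k / N = X / N := by push_cast; ring
      rw [h3] at h2
      push_cast at h2 ⊢
      linarith
  have hlim : Tendsto (fun N : ℕ => φ 0 - C * X ^ 2 * ((N : ℝ))⁻¹) atTop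
      (𝓝 (φ 0 - C * X ^ 2 * 0)) :=
    tendsto_const_nhds.sub (tendsto_const_nhds.mul tendsto_inv_atTop_nhds_zero_nat)
  have := le_of_tendsto hlim (b := φ X) (by
    filter_upwards [eventually_gt_atTop 0] with N hN
    have hN' : (0 : ℝ) < N := by exact_mod_cast hN
    have := hstep N hN N le_rfl
    rw [mul_div_assoc, div_self hN'.ne', mul_one] at this
    have e : (N : ℝ) * (C * (X / N) ^ 2) = C * X ^ 2 * (N : ℝ)⁻¹ := by field_simp
    linarith)
  linarith

/-- Since `2x / (1 - x²)` is the derivative of `-log (1 - z²)` at `z = x`, this is a Taylor estimate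
with a uniform constant on `[0, X]`. -/
theorem log_one_sub_sq_defect {X x y : ℝ} (hX : X < 1) (hy : 0 ≤ y) (hyx : y ≤ x) (hx : x ≤ X) :
    2 * (x - y) * (x / (1 - x ^ 2)) ≤
      Real.log (1 - y ^ 2) - Real.log (1 - x ^ 2) + 4 / (1 - X ^ 2) ^ 2 * (x - y) ^ 2 := by
  have hXp : 0 < 1 - X ^ 2 := by nlinarith
  have hxX : 1 - X ^ 2 ≤ 1 - x ^ 2 := by nlinarith
  have hyX : 1 - X ^ 2 ≤ 1 - y ^ 2 := by nlinarith
  have hxp := hXp.trans_le hxX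
  have hyp := hXp.trans_le hyX
  have hlog : (x ^ 2 - y ^ 2) / (1 - y ^ 2) ≤ Real.log (1 - y ^ 2) - Real.log (1 - x ^ 2) := by
    have := Real.log_le_sub_one_of_pos (div_pos hxp hyp)
    rw [Real.log_div hxp.ne' hyp.ne'] at this
    have e : (x ^ 2 - y ^ 2) / (1 - y ^ 2) = 1 - (1 - x ^ 2) / (1 - y ^ 2) := by field_simp; ring
    linarith
  have hmain : 2 * (x - y) * (x / (1 - x ^ 2)) - (x ^ 2 - y ^ 2) / (1 - y ^ 2) ≤
      4 / (1 - X ^ 2) ^ 2 * (x - y) ^ 2 := by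
    have e : 2 * (x - y) * (x / (1 - x ^ 2)) - (x ^ 2 - y ^ 2) / (1 - y ^ 2) =
        (x - y) ^ 2 * (1 + x ^ 2 + 2 * x * y) / ((1 - x ^ 2) * (1 - y ^ 2)) := by
      field_simp; ring
    rw [e, div_mul_eq_mul_div]
    refine div_le_div₀ (by positivity) ?_ (by positivity) ?_
    · have : 1 + x ^ 2 + 2 * x * y ≤ 4 := by nlinarith
      nlinarith [sq_nonneg (x - y)]
    · rw [sq]; gcongr
  linarith

/-- Sidorenko's inequality for `τ`. -/
theorem card_mul_log_le_log_tau {V : Type*} [Fintype V] [DecidableEq V] (G : SimpleGraph V)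
    [DecidableRel G.Adj] {x : ℝ} (h0 : 0 ≤ x) (h1 : x < 1) :
    (G.edgeFinset.card : ℝ) * Real.log (1 - x ^ 2) ≤ Real.log (tau G x) := by
  have hex : ∀ z : ℝ, 0 ≤ z ∧ z < 1 → ∃ A, A ∈ cappedAdmissible G z ∧
      ∀ M ∈ cappedAdmissible G z, M.det ≤ A.det := fun z hz =>
    exists_isMaxOn_cappedAdmissible G hz.1 hz.2
  choose! A hA hmax using hex
  set e : ℝ := (G.edgeFinset.card : ℝ) with he
  have he0 : 0 ≤ e := by positivity
  have h := le_of_quadratic_defect (φ := fun z => Real.log (A z).det - e * Real.log (1 - z ^ 2))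
    (C := e * (4 / (1 - x ^ 2) ^ 2)) h0 (by
      intro y z hy hyz hzx
      have hz1 : z < 1 := by linarith
      have hz0 : 0 ≤ z := hy.trans hyz
      have hy1 : y < 1 := by linarith
      have hz := hA z ⟨hz0, hz1⟩
      have l1 := log_det_le_log_det_add hz.1.1
        (Matrix.mul_nonsing_inv _ ((Matrix.isUnit_iff_isUnit_det _).1 hz.1.1.isUnit))
        (hA y ⟨hy, hy1⟩).1.1
      have l2 := trace_mul_sub_le hz0 hz1 hyz hz (hmax z ⟨hz0, hz1⟩) (hA y ⟨hy, hy1⟩)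
      have l3 := mul_le_mul_of_nonneg_left (log_one_sub_sq_defect h1 hy hyz hzx) he0
      rw [← he] at l2
      nlinarith)
  have hone : (1 : Matrix V V ℝ) ∈ cappedAdmissible G 0 :=
    ⟨⟨Matrix.PosDef.one, fun v => by simp, fun u v h => by simp [h.ne]⟩,
      fun u v h => by simp [h]⟩
  have h2 := hmax 0 ⟨le_rfl, one_pos⟩ 1 hone
  rw [Matrix.det_one] at h2
  have h3 := Real.log_nonneg h2
  have h4 := (covMatrix_isDetMaximizer G h0 h1).2 _ (hA x ⟨h0, h1⟩).1
  have h5 := Real.log_le_log (hA x ⟨h0, h1⟩).1.1.det_pos h4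
  simp only [ne_eq, OfNat.ofNat_ne_zero, not_false_eq_true, zero_pow, sub_zero, Real.log_one,
    mul_zero] at h
  rw [tau]
  linarith

/-! ### The gap above the Sidorenko bound -/

/-- A lower bound for the growth rate per edge of `τ(G, x)` above `(1 - x²)^e(G)`, in terms of the
average degree `d`. -/
noncomputable def sidorenkoGap (d x : ℝ) : ℝ :=
  2 / d * Real.log ((1 - x) / (1 - 1 / (d - 1))) + Real.log (1 - (1 / (d - 1)) ^ 2) -
    Real.log (1 - x ^ 2)

theorem sidorenkoGap_pos {d x : ℝ} (hd : 1 < d) (hx : 1 / (d - 1) < x) (hx1 : x < 1) :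
    0 < sidorenkoGap d x := by
  obtain ⟨D, rfl⟩ : ∃ D, d = D + 1 := ⟨d - 1, by ring⟩
  rw [sidorenkoGap]
  simp only [add_sub_cancel_right] at hx ⊢
  have hD0 : 0 < D := by linarith
  have hDx : 1 < x * D := (div_lt_iff₀ hD0).1 hx
  have hD : 1 < D := by nlinarith
  have hx0 : 0 < x := (by positivity : 0 < 1 / D).trans hx
  set A := (1 - x) / (1 - 1 / D) with hA
  have hA' : A = (1 - x) * D / (D - 1) := by
    have : D - 1 ≠ 0 := by linarith
    rw [hA]; field_simp
  have hApos : 0 < A := by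
    rw [hA']
    exact div_pos (mul_pos (by linarith) hD0) (by linarith)
  set B := (1 + x) * D / (D + 1) with hB
  have hBpos : 0 < B := by positivity
  have hB1 : B ≠ 1 := by
    rw [hB, ne_eq, div_eq_one_iff_eq (by positivity)]
    nlinarith
  have hy : 0 < 1 - (1 / D) ^ 2 := by
    have : 1 / D < 1 := (div_lt_one hD0).2 hD
    have : 0 < 1 / D := by positivity
    nlinarith
  have hAB : 1 - x ^ 2 = A * B * (1 - (1 / D) ^ 2) := by
    have : D - 1 ≠ 0 := by linarith
    rw [hA', hB]; field_simp; ring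
  rw [hAB, Real.log_mul (by positivity) hy.ne', Real.log_mul hApos.ne' hBpos.ne']
  have h1 := Real.log_le_sub_one_of_pos hApos
  have h2 := Real.log_lt_sub_one_of_pos hBpos hB1
  -- With `y = 1 / D`, `A = (1 - x) / (1 - y)` and `B = (1 + x) / (1 + y)`, the gap is `-((D - 1) /
  -- (D + 1) * log A + log B)`. The tangent line bounds of the two logarithms cancel with these
  -- weights.
  have h3 : (D - 1) / (D + 1) * (A - 1) + (B - 1) = 0 := by
    have : D - 1 ≠ 0 := by linarith
    rw [hA', hB]; field_simp; ring
  have h4 : 2 / (D + 1) = 1 - (D - 1) / (D + 1) := by field_simp; ring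
  have h5 : 0 ≤ (D - 1) / (D + 1) := div_nonneg (by linarith) (by linarith)
  rw [h4]
  nlinarith [mul_le_mul_of_nonneg_left h1 h5]

section
variable {V : Type*} [Fintype V] [DecidableEq V]

theorem log_det_le_log_det_add_posSemidef {M N : Matrix V V ℝ} (hM : M.PosDef)
    (hN : N.PosSemidef) : Real.log M.det ≤ Real.log (M + N).det := by
  have hMN := hM.add_posSemidef hN
  have hu := (Matrix.isUnit_iff_isUnit_det _).1 hMN.isUnit
  have h := log_det_le_log_det_add hMN (Matrix.mul_nonsing_inv _ hu) hM
  have htr : ((M + N)⁻¹ * M).trace - Fintype.card V = -((M + N)⁻¹ * N).trace := by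
    have : ((M + N)⁻¹ * (M + N)).trace = Fintype.card V := by
      rw [Matrix.nonsing_inv_mul _ hu]; simp
    rw [Matrix.mul_add, Matrix.trace_add] at this
    linarith
  have hpos : 0 ≤ ((M + N)⁻¹ * N).trace := by
    obtain ⟨C, hC⟩ : ∃ C : Matrix V V ℝ, N = Cᴴ * C := by
      open scoped MatrixOrder in
      exact CStarAlgebra.nonneg_iff_eq_star_mul_self.1 hN.nonneg
    rw [hC, ← Matrix.mul_assoc, Matrix.trace_mul_comm, ← Matrix.mul_assoc, ← hC]
    exact (hMN.inv.posSemidef.mul_mul_conjTranspose_same C).trace_nonneg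
  linarith

/-- With `b y + (1 - b) = x`, the matrix `b A_G(y) + (1 - b) J`, `J` all ones, is admissible at `x`,
and its determinant is at least `b^|V| τ(G, y)`. -/
theorem card_mul_log_add_log_tau_le (G : SimpleGraph V) {x y : ℝ} (hy : 0 ≤ y) (hyx : y ≤ x)
    (hx : x < 1) :
    Fintype.card V * Real.log ((1 - x) / (1 - y)) + Real.log (tau G y) ≤ Real.log (tau G x) := by
  have hy1 : 0 < 1 - y := by linarith
  set b := (1 - x) / (1 - y) with hb
  have hb0 : 0 < b := div_pos (by linarith) hy1
  have hb1 : 0 ≤ 1 - b := by rw [hb, sub_nonneg, div_le_one hy1]; linarith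
  have hby : b * y + (1 - b) = x := by rw [hb]; field_simp; ring
  obtain ⟨hA, hAd, hAe⟩ := (covMatrix_isDetMaximizer G hy (by linarith)).1
  have hJ : ((1 - b) • Matrix.vecMulVec (fun _ : V => (1 : ℝ)) (star fun _ => 1)).PosSemidef :=
    (Matrix.posSemidef_vecMulVec_self_star _).smul hb1
  have h1 := log_det_le_log_det_add_posSemidef (hA.smul hb0) hJ
  have hmem : b • covMatrix G y + (1 - b) • Matrix.vecMulVec (fun _ : V => (1 : ℝ))
      (star fun _ => 1) ∈ admissible G x := by
    refine ⟨(hA.smul hb0).add_posSemidef hJ, fun v => ?_, fun u v huv => ?_⟩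
    · simp [Matrix.vecMulVec_apply, hAd]
    · simp [Matrix.vecMulVec_apply, hAe u v huv, hby]
  have h2 := (covMatrix_isDetMaximizer G (hy.trans hyx) hx).2 _ hmem
  have h3 := Real.log_le_log hmem.1.det_pos h2
  rw [Matrix.det_smul, Real.log_mul (by positivity) hA.det_pos.ne', Real.log_pow] at h1
  exact h1.trans h3

theorem sidorenkoGap_le (G : SimpleGraph V) [DecidableRel G.Adj] {x : ℝ} (hd : 1 < avgDegree G)
    (hx : 1 / (avgDegree G - 1) < x) (hx1 : x < 1) :
    sidorenkoGap (avgDegree G) x ≤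
      Real.log (tau G x) / (G.edgeFinset.card : ℝ) - Real.log (1 - x ^ 2) := by
  set d := avgDegree G with hdef
  -- The point `y = 1 / (d - 1)` is critical for `2 / d * log ((1 - x) / (1 - y)) + log (1 - y²)`,
  -- the resulting bound per edge.
  have hy0 : 0 < 1 / (d - 1) := one_div_pos.2 (by linarith)
  have h1 := card_mul_log_add_log_tau_le G hy0.le hx.le hx1
  have h2 := card_mul_log_le_log_tau G hy0.le (hx.trans hx1)
  have hsum : ∑ v, (G.degree v : ℝ) = 2 * G.edgeFinset.card := by
    exact_mod_cast G.sum_degrees_eq_twice_card_edges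
  have hn : (Fintype.card V : ℝ) ≠ 0 := by
    intro h0
    rw [hdef, avgDegree, h0, div_zero] at hd
    linarith
  have hn' : (0 : ℝ) < Fintype.card V := lt_of_le_of_ne (by positivity) hn.symm
  have hde : d * Fintype.card V = 2 * G.edgeFinset.card := by
    rw [hdef, avgDegree, hsum]; field_simp
  have he : (0 : ℝ) < G.edgeFinset.card := by nlinarith
  have hn2 : (Fintype.card V : ℝ) = 2 / d * G.edgeFinset.card := by field_simp; linarith
  rw [hn2] at h1
  rw [sidorenkoGap, sub_le_sub_iff_right, le_div_iff₀ he]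
  linarith
end

/-! ### Determinants of `1 - xB` when the first traces vanish -/

section Resolvent
variable {ι : Type*} [Fintype ι] [DecidableEq ι]

theorem hasDerivAt_det_one_sub_smul (B : Matrix ι ι ℝ) {t : ℝ} (R : Matrix ι ι ℝ)
    (hR : (1 - t • B) * R = 1) :
    HasDerivAt (fun s : ℝ => (1 - s • B).det) (-(1 - t • B).det * (R * B).trace) t := by
  obtain ⟨p, hp⟩ : ∃ p : Polynomial ℝ, ∀ r : ℝ,
      (1 + r • (-(R * B))).det = 1 + (-(R * B)).trace * r + p.eval r * r ^ 2 :=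
    ⟨_, fun r => Matrix.det_one_add_smul r _⟩
  have hfac : (fun s : ℝ => (1 - s • B).det) = fun s =>
      (1 - t • B).det * (1 + (-(R * B)).trace * (s - t) + p.eval (s - t) * (s - t) ^ 2) := by
    ext s
    rw [← hp, ← Matrix.det_mul, Matrix.mul_add, Matrix.mul_smul, Matrix.mul_neg,
      ← Matrix.mul_assoc, hR]
    congr 1
    simp only [mul_one, one_mul, smul_neg, sub_smul]
    abel
  rw [hfac]
  have h1 : HasDerivAt (fun s : ℝ => s - t) 1 t := (hasDerivAt_id t).sub_const t
  have h2 : HasDerivAt (fun s : ℝ => p.eval (s - t)) (p.derivative.eval (t - t)) t :=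
    (p.hasDerivAt (t - t)).comp_sub_const t t
  refine ((((h1.const_mul (-(R * B)).trace).const_add 1).add (h2.mul (h1.pow 2))).const_mul
    (1 - t • B).det).congr_deriv ?_
  simp

/-- Iterating `R = 1 + t R B` peels off powers of `B` of trace zero. -/
theorem trace_resolvent_mul_eq (B : Matrix ι ι ℝ) {t : ℝ} {R : Matrix ι ι ℝ}
    (hR : R * (1 - t • B) = 1) {m : ℕ} (htr : ∀ k, 1 ≤ k → k ≤ m → (B ^ k).trace = 0) :
    (R * B).trace = t ^ m * (R * B ^ (m + 1)).trace := by
  induction m with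
  | zero => simp
  | succ m ih =>
    rw [ih fun k h1 h2 => htr k h1 (h2.trans (Nat.le_succ m))]
    have hR' : R = 1 + t • (R * B) := by
      rw [Matrix.mul_sub, Matrix.mul_one, Matrix.mul_smul, sub_eq_iff_eq_add] at hR
      exact hR
    have : R * B ^ (m + 1) = B ^ (m + 1) + t • (R * B ^ (m + 2)) := by
      conv_lhs => rw [hR', Matrix.add_mul, Matrix.one_mul, Matrix.smul_mul, Matrix.mul_assoc,
        ← pow_succ']
    rw [this, Matrix.trace_add, htr (m + 1) (by omega) le_rfl, Matrix.trace_smul]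
    simp only [smul_eq_mul]
    ring

attribute [local instance] Matrix.linftyOpNormedRing Matrix.linftyOpNormedAlgebra

theorem linftyOpNorm_le {B : Matrix ι ι ℝ} {b : ℝ} (hb : 0 ≤ b)
    (hB : ∀ i, ∑ j, |B i j| ≤ b) : ‖B‖ ≤ b := by
  rw [Matrix.linfty_opNorm_def]
  lift b to NNReal using hb
  refine NNReal.coe_le_coe.2 (Finset.sup_le fun i _ => ?_)
  rw [← NNReal.coe_le_coe]
  push_cast
  exact hB i

theorem abs_trace_le (B : Matrix ι ι ℝ) : |B.trace| ≤ Fintype.card ι * ‖B‖ := by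
  refine (abs_sum_le_sum_abs _ _).trans ?_
  rw [← nsmul_eq_mul, ← Finset.card_univ]
  refine sum_le_card_nsmul _ _ _ fun i _ => ?_
  rw [Matrix.linfty_opNorm_def]
  have h1 : ‖B i i‖₊ ≤ ∑ j, ‖B i j‖₊ :=
    single_le_sum (f := fun j => ‖B i j‖₊) (fun _ _ => zero_le) (mem_univ i)
  have h2 : ∑ j, ‖B i j‖₊ ≤ (univ : Finset ι).sup fun i => ∑ j, ‖B i j‖₊ :=
    le_sup (f := fun i => ∑ j, ‖B i j‖₊) (mem_univ i)
  exact NNReal.coe_le_coe.2 (h1.trans h2)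

theorem abs_trace_resolvent_le {B R : Matrix ι ι ℝ} {b t : ℝ} (hb : 0 ≤ b) (ht : 0 ≤ t)
    (hbt : b * t < 1) (hB : ∀ i, ∑ j, |B i j| ≤ b) (hR : (1 - t • B) * R = 1) (m : ℕ) :
    |(R * B ^ m).trace| ≤ Fintype.card ι * (b ^ m / (1 - b * t)) := by
  rcases isEmpty_or_nonempty ι with hι | hι
  · simp [Matrix.trace]
  have hBn := linftyOpNorm_le hb hB
  have hRn : ‖R‖ ≤ 1 / (1 - b * t) := by
    have hR' : R = 1 + t • (B * R) := by
      rw [Matrix.sub_mul, Matrix.one_mul, Matrix.smul_mul, sub_eq_iff_eq_add] at hR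
      exact hR
    have h1 : ‖R‖ ≤ 1 + t * (b * ‖R‖) := by
      calc ‖R‖ = ‖1 + t • (B * R)‖ := by rw [← hR']
        _ ≤ ‖(1 : Matrix ι ι ℝ)‖ + ‖t • (B * R)‖ := norm_add_le _ _
        _ ≤ 1 + t * (b * ‖R‖) := by
          rw [norm_smul, Real.norm_of_nonneg ht]
          gcongr
          · exact linftyOpNorm_le zero_le_one fun i => by simp [Matrix.one_apply, apply_ite abs]
          · exact (norm_mul_le _ _).trans (by gcongr)
    rw [le_div_iff₀ (by linarith)]
    linarith
  refine (abs_trace_le _).trans ?_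
  gcongr
  calc ‖R * B ^ m‖ ≤ ‖R‖ * ‖B ^ m‖ := norm_mul_le _ _
    _ ≤ 1 / (1 - b * t) * b ^ m := by
      gcongr
      rcases m.eq_zero_or_pos with rfl | hm
      · rw [pow_zero, pow_zero]
        exact linftyOpNorm_le zero_le_one fun i => by simp [Matrix.one_apply, apply_ite abs]
      · exact (norm_pow_le' B hm).trans (by gcongr)
    _ = _ := by ring

theorem isUnit_one_sub_smul {B : Matrix ι ι ℝ} {b t : ℝ} (hb : 0 ≤ b) (ht : 0 ≤ t)
    (hbt : b * t < 1) (hB : ∀ i, ∑ j, |B i j| ≤ b) : IsUnit (1 - t • B) := by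
  refine isUnit_one_sub_of_norm_lt_one ?_
  rw [norm_smul, Real.norm_of_nonneg ht]
  exact (mul_le_mul_of_nonneg_left (linftyOpNorm_le hb hB) ht).trans_lt (by linarith)

/-- If the traces of the first powers of `B` vanish, then `det (1 - xB)` is close to one. -/
theorem neg_log_det_one_sub_smul_le {B : Matrix ι ι ℝ} {b x : ℝ} (hb : 0 ≤ b) (hx : 0 ≤ x)
    (hbx : b * x < 1) (hB : ∀ i, ∑ j, |B i j| ≤ b) {m : ℕ}
    (htr : ∀ k, 1 ≤ k → k ≤ m → (B ^ k).trace = 0) :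
    -Real.log (1 - x • B).det ≤ Fintype.card ι * ((b * x) ^ (m + 1) / (1 - b * x)) := by
  set N : ℝ := (Fintype.card ι : ℝ) with hN
  set c : ℝ := N * (b ^ (m + 1) / (1 - b * x)) with hc
  have hbx' : 0 < 1 - b * x := by linarith
  have hc0 : 0 ≤ c := by positivity
  have hderiv : ∀ t ∈ Set.Icc 0 x, HasDerivAt
      (fun s : ℝ => Real.log (1 - s • B).det + c * s ^ (m + 1))
      (-(((1 - t • B)⁻¹ * B).trace) + c * ((m + 1 : ℕ) * t ^ m)) t := by
    intro t ht
    have hbt : b * t < 1 := (mul_le_mul_of_nonneg_left ht.2 hb).trans_lt hbx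
    have hu := (Matrix.isUnit_iff_isUnit_det _).1 (isUnit_one_sub_smul hb ht.1 hbt hB)
    have h1 := (hasDerivAt_det_one_sub_smul B _ (Matrix.mul_nonsing_inv _ hu)).log hu.ne_zero
    have h2 := (hasDerivAt_pow (m + 1) t).const_mul c
    refine (h1.add h2).congr_deriv ?_
    have := hu.ne_zero
    field_simp
    simp
  have hmono : MonotoneOn (fun s : ℝ => Real.log (1 - s • B).det + c * s ^ (m + 1))
      (Set.Icc 0 x) := by
    refine monotoneOn_of_deriv_nonneg (convex_Icc 0 x)
      (fun t ht => (hderiv t ht).continuousAt.continuousWithinAt)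
      (fun t ht => (hderiv t (interior_subset ht)).differentiableAt.differentiableWithinAt)
      fun t ht => ?_
    have ht' : t ∈ Set.Icc 0 x := interior_subset ht
    rw [(hderiv t ht').deriv]
    have hbt' : b * t ≤ b * x := mul_le_mul_of_nonneg_left ht'.2 hb
    have hbt : b * t < 1 := hbt'.trans_lt hbx
    have hu := (Matrix.isUnit_iff_isUnit_det _).1 (isUnit_one_sub_smul hb ht'.1 hbt hB)
    rw [trace_resolvent_mul_eq B (Matrix.nonsing_inv_mul _ hu) htr]
    have h1 := abs_trace_resolvent_le hb ht'.1 hbt hB (Matrix.mul_nonsing_inv _ hu) (m + 1)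
    have h2 : N * (b ^ (m + 1) / (1 - b * t)) ≤ c := by
      rw [hc]
      have : 0 < 1 - b * t := by linarith
      gcongr
    have h3 := (le_abs_self _).trans (h1.trans h2)
    have h4 : 0 ≤ t ^ m := pow_nonneg ht'.1 m
    have h5 := mul_le_mul_of_nonneg_left h3 h4
    -- The derivative of `c s^(m+1)` is `(m + 1) c t^m`; only `c t^m` is needed, and the surplus is
    -- discarded.
    have h6 : 0 ≤ c * (m * t ^ m) := by positivity
    push_cast
    nlinarith
  have h := hmono ⟨le_rfl, hx⟩ ⟨hx, le_rfl⟩ hx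
  simp only [zero_smul, sub_zero, Matrix.det_one, Real.log_one, ne_eq, Nat.add_eq_zero_iff,
    one_ne_zero, and_false, not_false_eq_true, zero_pow, mul_zero, add_zero] at h
  have e : c * x ^ (m + 1) = N * ((b * x) ^ (m + 1) / (1 - b * x)) := by
    rw [hc, mul_pow]; ring
  linarith
end Resolvent

/-! ### Nonbacktracking walks and girth -/

section Nonbacktracking
variable {V : Type*} {G : SimpleGraph V}

/-- A nonbacktracking closed vertex sequence of length `k` contains a cycle of length at most
`k`. -/
theorem egirth_le_of_nonbacktracking {k : ℕ} (hk : 1 ≤ k) (w : ℕ → V)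
    (hadj : ∀ i, i < k → G.Adj (w i) (w (i + 1)))
    (hnb : ∀ i, i + 2 ≤ k → w i ≠ w (i + 2)) (hclosed : w 0 = w k) : G.egirth ≤ k := by
  classical
  have hex : ∃ n, 1 ≤ n ∧ ∃ i, i + n ≤ k ∧ w i = w (i + n) :=
    ⟨k, hk, 0, by omega, by rw [zero_add]; exact hclosed⟩
  -- At the least gap `n` between equal terms, the window of `n` vertices is injective; adjacency
  -- and nonbacktracking force `n ≥ 3`, so it is a copy of a cycle.
  set n := Nat.find hex with hn
  obtain ⟨hn1, i, hik, hwi⟩ := Nat.find_spec hex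
  rw [← hn] at hn1 hik hwi
  have hmin : ∀ m, 1 ≤ m → m < n → ∀ j, j + m ≤ k → w j ≠ w (j + m) := by
    intro m hm1 hmn j hj he
    exact Nat.find_min hex hmn ⟨hm1, j, hj, he⟩
  have hn3 : 2 < n := by
    by_contra hlt
    have : n = 1 ∨ n = 2 := by omega
    rcases this with h | h
    · rw [h] at hik hwi
      exact (hadj i (by omega)).ne hwi
    · rw [h] at hik hwi
      exact hnb i hik hwi
  have hstep : ∀ u v : Fin n, (v - u).val = 1 → G.Adj (w (i + u)) (w (i + v)) := by
    intro u v huv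
    rw [Fin.sub_def] at huv
    simp only at huv
    have hu := u.isLt
    have hv := v.isLt
    by_cases hc : u.val + 1 < n
    · have hvu : v.val = u.val + 1 := by
        by_cases hle : u.val ≤ v.val
        · rw [show n - u.val + v.val = (v.val - u.val) + n by omega, Nat.add_mod_right,
            Nat.mod_eq_of_lt (by omega)] at huv
          omega
        · rw [Nat.mod_eq_of_lt (by omega)] at huv
          omega
      rw [hvu, ← add_assoc]
      exact hadj _ (by omega)
    · have hun : u.val = n - 1 := by omega
      have hv0 : v.val = 0 := by
        by_contra hv0
        rw [hun] at huv
        by_cases hvn : v.val = n - 1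
        · rw [show n - (n - 1) + v.val = n by omega, Nat.mod_self] at huv
          omega
        · rw [Nat.mod_eq_of_lt (by omega)] at huv
          omega
      rw [hv0, add_zero, hwi, hun, show i + n = i + (n - 1) + 1 by omega]
      exact hadj _ (by omega)
  have hcont : (SimpleGraph.cycleGraph n).IsContained G := by
    refine ⟨⟨⟨fun u => w (i + u.val), ?_⟩, ?_⟩⟩
    · intro u v huv
      rcases SimpleGraph.cycleGraph_adj'.1 huv with h | h
      · exact (hstep v u h).symm
      · exact hstep u v h
    · intro u v huv
      simp only [RelHom.coeFn_mk] at huv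
      rcases lt_trichotomy u.val v.val with h | h | h
      · exact absurd (by rw [huv]; congr 1; omega)
          (hmin (v.val - u.val) (by omega) (by omega) (i + u.val) (by omega))
      · exact Fin.ext h
      · exact absurd (by rw [← huv]; congr 1; omega)
          (hmin (u.val - v.val) (by omega) (by omega) (i + v.val) (by omega))
  obtain ⟨v, p, hp, hpl⟩ := (SimpleGraph.cycleGraph_isContained_iff hn3).1 hcont
  refine (SimpleGraph.egirth_le_length hp).trans ?_
  rw [hpl]
  exact_mod_cast (by omega : n ≤ k)

theorem exists_chain_of_pow_apply_ne_zero {ι : Type*} [Fintype ι] [DecidableEq ι]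
    {B : Matrix ι ι ℝ} {k : ℕ} {a b : ι} (h : (B ^ k) a b ≠ 0) :
    ∃ d : ℕ → ι, d 0 = a ∧ d k = b ∧ ∀ i, i < k → B (d i) (d (i + 1)) ≠ 0 := by
  induction k generalizing a with
  | zero =>
    refine ⟨fun _ => a, rfl, ?_, by simp⟩
    by_contra hab
    exact h (by rw [pow_zero, Matrix.one_apply_ne hab])
  | succ k ih =>
    rw [pow_succ', Matrix.mul_apply] at h
    obtain ⟨c, -, hc⟩ := exists_ne_zero_of_sum_ne_zero h
    obtain ⟨d, hd0, hdk, hd⟩ := ih (right_ne_zero_of_mul hc)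
    refine ⟨fun i => Nat.casesOn i a d, rfl, hdk, fun i hi => ?_⟩
    cases i with
    | zero => simpa [hd0] using left_ne_zero_of_mul hc
    | succ i => exact hd i (by omega)

variable [Fintype V] [DecidableEq V] [DecidableRel G.Adj]

variable (G) in
/-- The Hashimoto matrix: transitions between consecutive darts which are not reversals. -/
def nonbacktrackingMatrix : Matrix G.Dart G.Dart ℝ :=
  .of fun a b => if a.snd = b.fst ∧ b ≠ a.symm then 1 else 0

theorem trace_nonbacktrackingMatrix_pow {k : ℕ} (hk : 1 ≤ k) (hg : (k : ℕ∞) < G.egirth) :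
    (nonbacktrackingMatrix G ^ k).trace = 0 := by
  refine sum_eq_zero fun a _ => ?_
  by_contra hne
  obtain ⟨d, hd0, hdk, hd⟩ := exists_chain_of_pow_apply_ne_zero hne
  have hd' : ∀ i, i < k → (d i).snd = (d (i + 1)).fst ∧ d (i + 1) ≠ (d i).symm := by
    intro i hi
    by_contra hc
    exact hd i hi (by simp only [nonbacktrackingMatrix, Matrix.of_apply, if_neg hc])
  refine hg.not_ge (egirth_le_of_nonbacktracking hk (fun i => (d i).fst) ?_ ?_ ?_)
  · intro i hi
    rw [← (hd' i hi).1]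
    exact (d i).adj
  · intro i hi he
    have h1 := hd' i (by omega)
    have h2 := hd' (i + 1) (by omega)
    refine h1.2 (SimpleGraph.Dart.ext _ _ (Prod.ext ?_ ?_))
    · exact h1.1.symm
    · exact h2.1.trans he.symm
  · rw [hd0, hdk]

theorem sum_abs_nonbacktrackingMatrix_le (a : G.Dart) :
    ∑ b, |nonbacktrackingMatrix G a b| ≤ (G.maxDegree : ℝ) - 1 := by
  have h1 : ∑ b, |nonbacktrackingMatrix G a b| =
      #((univ.filter fun b : G.Dart => b.fst = a.snd).erase a.symm) := by
    simp only [nonbacktrackingMatrix, Matrix.of_apply, apply_ite abs, abs_one, abs_zero,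
      sum_boole]
    congr 2
    ext b
    simp [and_comm, eq_comm]
  rw [h1, card_erase_of_mem (by simp), G.dart_fst_fiber_card_eq_degree]
  have h2 : 0 < G.degree a.snd := (G.degree_pos_iff_exists_adj _).2 ⟨_, a.adj.symm⟩
  have h3 := G.degree_le_maxDegree a.snd
  rw [Nat.cast_sub h2]
  have : (G.degree a.snd : ℝ) ≤ G.maxDegree := by exact_mod_cast h3
  push_cast
  linarith

end Nonbacktracking

/-! ### Dart matrices, Ihara-Bass and the dual bound -/

section Dart
variable {V : Type*} [Fintype V] [DecidableEq V] (G : SimpleGraph V)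

/-- Incidence of darts with their initial vertices. -/
def dartSource : Matrix V G.Dart ℝ := .of fun v a => if a.fst = v then 1 else 0

/-- Incidence of darts with their terminal vertices. -/
def dartTarget : Matrix V G.Dart ℝ := .of fun v a => if a.snd = v then 1 else 0

/-- The permutation matrix of dart reversal. -/
def dartReversal : Matrix G.Dart G.Dart ℝ := .of fun a b => if b = a.symm then 1 else 0

theorem nonbacktrackingMatrix_eq :
    nonbacktrackingMatrix G = (dartTarget G)ᵀ * dartSource G - dartReversal G := by
  ext a b
  simp only [nonbacktrackingMatrix, Matrix.of_apply, Matrix.sub_apply, Matrix.mul_apply,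
    Matrix.transpose_apply, dartTarget, dartSource, dartReversal]
  by_cases h : b = a.symm
  · simp [h]
  · simp [h, eq_comm]

end Dart

section IharaBass
variable {V : Type*} [Fintype V] [DecidableEq V] (G : SimpleGraph V) [DecidableRel G.Adj]

/-- The inverse covariance matrix which is exact on trees. -/
noncomputable def treeConcentration (x : ℝ) : Matrix V V ℝ :=
  1 - (x / (1 - x ^ 2)) • (G.adjMatrix ℝ - x • G.degMatrix ℝ)

theorem treeConcentration_posDef {x : ℝ} (h0 : 0 ≤ x) (h1 : x < 1)
    (hΔ : ((G.maxDegree : ℝ) - 1) * x < 1) : (treeConcentration G x).PosDef := by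
  have hx : 0 < 1 - x ^ 2 := by nlinarith
  -- The diagonal part at `v` is `1 - x deg(v) / (1 + x)`, positive exactly when `(deg(v) - 1) x <
  -- 1`.
  have e : treeConcentration G x =
      Matrix.diagonal (fun v => 1 - x / (1 - x ^ 2) * ((1 - x) * G.degree v)) +
        (x / (1 - x ^ 2)) • G.lapMatrix ℝ := by
    ext i j
    by_cases hij : i = j
    · subst hij
      simp [treeConcentration, SimpleGraph.lapMatrix, SimpleGraph.degMatrix]
      ring
    · simp [treeConcentration, SimpleGraph.lapMatrix, SimpleGraph.degMatrix, hij]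
  rw [e]
  refine Matrix.PosDef.add_posSemidef (Matrix.PosDef.diagonal fun v => ?_)
    ((G.posSemidef_lapMatrix ℝ).smul (by positivity))
  have hd : (G.degree v : ℝ) ≤ G.maxDegree := by exact_mod_cast G.degree_le_maxDegree v
  have h2 : x / (1 - x ^ 2) * ((1 - x) * G.degree v) = x * G.degree v / (1 + x) := by
    have h3 : 1 - x ≠ 0 := by linarith
    have h4 : 1 + x ≠ 0 := by linarith
    have h5 : 1 - x ^ 2 = (1 - x) * (1 + x) := by ring
    rw [h5]; field_simp
  rw [h2, sub_pos, div_lt_one (by linarith)]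
  nlinarith

/-- Only the prescribed entries of `A` enter, and the adjacency and degree terms both give `x ∑
deg(v)`, so they cancel. -/
theorem trace_treeConcentration_mul {x : ℝ} {A : Matrix V V ℝ} (hA : A ∈ admissible G x) :
    (treeConcentration G x * A).trace = Fintype.card V := by
  obtain ⟨-, hd, he⟩ := hA
  have h1 : (G.adjMatrix ℝ * A).trace = x * ∑ v, (G.degree v : ℝ) := by
    simp only [Matrix.trace, Matrix.diag, SimpleGraph.adjMatrix_mul_apply, mul_sum]
    refine sum_congr rfl fun v _ => ?_
    rw [sum_congr rfl fun u hu => he u v ((G.mem_neighborFinset v u).1 hu).symm]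
    simp [mul_comm]
  have h2 : (G.degMatrix ℝ * A).trace = ∑ v, (G.degree v : ℝ) := by
    simp [Matrix.trace, SimpleGraph.degMatrix, Matrix.diagonal_mul, hd]
  have h3 : A.trace = Fintype.card V := by simp [Matrix.trace, hd]
  rw [treeConcentration, Matrix.sub_mul, Matrix.one_mul, Matrix.smul_mul, Matrix.sub_mul,
    Matrix.smul_mul, Matrix.trace_sub, Matrix.trace_smul, Matrix.trace_sub, Matrix.trace_smul,
    h1, h2, h3]
  simp

theorem log_tau_le_neg_log_det_treeConcentration {x : ℝ} (h0 : 0 ≤ x) (h1 : x < 1)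
    (hΔ : ((G.maxDegree : ℝ) - 1) * x < 1) :
    Real.log (tau G x) ≤ -Real.log (treeConcentration G x).det := by
  have hA := (covMatrix_isDetMaximizer G h0 h1).1
  have h := log_det_add_log_det_le (treeConcentration_posDef G h0 h1 hΔ) hA.1
  rw [trace_treeConcentration_mul G hA] at h
  rw [tau]
  linarith

theorem dartReversal_mul_apply {ι : Type*} (N : Matrix G.Dart ι ℝ) (a : G.Dart) (i : ι) :
    (dartReversal G * N) a i = N a.symm i := by
  simp [Matrix.mul_apply, dartReversal]

theorem dartReversal_mul_self : dartReversal G * dartReversal G = 1 := by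
  ext a b
  rw [dartReversal_mul_apply]
  simp [dartReversal, Matrix.one_apply, eq_comm]

theorem one_add_smul_dartReversal_mul (x : ℝ) :
    (1 + x • dartReversal G) * (1 - x • dartReversal G) = (1 - x ^ 2) • 1 := by
  have h := dartReversal_mul_self G
  rw [Matrix.add_mul, Matrix.one_mul, Matrix.mul_sub, Matrix.mul_one, Matrix.smul_mul,
    Matrix.mul_smul, h, smul_smul, sub_smul, one_smul, ← sq]
  abel

theorem dartSource_mul_dartReversal : dartSource G * dartReversal G = dartTarget G := by
  ext v a
  have : ∀ b : G.Dart, a = b.symm ↔ b = a.symm := fun b =>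
    ⟨fun h => by rw [h, SimpleGraph.Dart.symm_symm], fun h => by rw [h, SimpleGraph.Dart.symm_symm]⟩
  simp [Matrix.mul_apply, dartReversal, dartSource, dartTarget, this]

theorem dartSource_mul_dartTarget_transpose :
    dartSource G * (dartTarget G)ᵀ = G.adjMatrix ℝ := by
  ext u v
  simp only [Matrix.mul_apply, dartSource, dartTarget, Matrix.transpose_apply, Matrix.of_apply,
    SimpleGraph.adjMatrix_apply, ← ite_and, mul_ite, mul_one, mul_zero]
  split_ifs with h
  · rw [sum_eq_single (⟨(u, v), h⟩ : G.Dart)]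
    · simp
    · intro a _ ha
      rw [if_neg]
      rintro ⟨h1, h2⟩
      exact ha (SimpleGraph.Dart.ext _ _ (Prod.ext h2 h1))
    · simp
  · refine sum_eq_zero fun a _ => if_neg ?_
    rintro ⟨rfl, rfl⟩
    exact h a.adj

theorem dartTarget_mul_transpose : dartTarget G * (dartTarget G)ᵀ = G.degMatrix ℝ := by
  have : (dartTarget G)ᵀ = dartReversal G * (dartSource G)ᵀ := by
    ext a v
    rw [dartReversal_mul_apply]
    simp [dartSource, dartTarget]
  rw [this, ← Matrix.mul_assoc]
  have h2 : dartTarget G * dartReversal G = dartSource G := by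
    rw [← dartSource_mul_dartReversal, Matrix.mul_assoc, dartReversal_mul_self, Matrix.mul_one]
  rw [h2]
  ext u v
  simp only [Matrix.mul_apply, dartSource, Matrix.transpose_apply, Matrix.of_apply,
    SimpleGraph.degMatrix, Matrix.diagonal_apply, ← ite_and, mul_ite, mul_one, mul_zero]
  split_ifs with h
  · subst h
    simp [sum_boole, G.dart_fst_fiber_card_eq_degree]
  · refine sum_eq_zero fun a _ => if_neg ?_
    rintro ⟨h1, h2⟩
    exact h (h2.symm.trans h1)

/-- The Ihara-Bass formula. -/
theorem det_one_sub_smul_nonbacktrackingMatrix {x : ℝ} (hx : 1 - x ^ 2 ≠ 0) :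
    (1 - x • nonbacktrackingMatrix G).det =
      (1 + x • dartReversal G).det * (treeConcentration G x).det := by
  set J := dartReversal G with hJ
  set S := dartSource G
  set T := dartTarget G
  set L : Matrix G.Dart G.Dart ℝ := (1 / (1 - x ^ 2)) • (1 - x • J) with hL
  have hinv : (1 + x • J) * L = 1 := by
    have := one_add_smul_dartReversal_mul G x
    rw [← hJ] at this
    rw [hL, Matrix.mul_smul, this, smul_smul, one_div_mul_cancel hx, one_smul]
  -- Since `B = Tᵀ S - J`, the matrix `1 - xB` is `1 + xJ` minus a product through `V`. Sylvester's
  -- identity then moves the second determinant from darts to vertices.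
  have hfac : 1 - x • nonbacktrackingMatrix G =
      (1 + x • J) * (1 - (L * Tᵀ) * (x • S)) := by
    rw [Matrix.mul_sub, ← Matrix.mul_assoc, ← Matrix.mul_assoc, hinv, Matrix.one_mul,
      nonbacktrackingMatrix_eq, Matrix.mul_smul, smul_sub, Matrix.mul_one]
    abel
  rw [hfac, Matrix.det_mul, Matrix.det_one_sub_mul_comm, treeConcentration]
  congr 2
  rw [← dartSource_mul_dartTarget_transpose, ← dartTarget_mul_transpose,
    ← dartSource_mul_dartReversal, hL]
  simp only [Matrix.smul_mul, Matrix.mul_smul, Matrix.sub_mul, Matrix.mul_sub, Matrix.one_mul,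
    smul_sub, smul_smul, Matrix.mul_assoc]
  rw [dartSource_mul_dartReversal, one_div_mul_eq_div]

theorem log_det_one_add_smul_dartReversal (x : ℝ) :
    Real.log (1 + x • dartReversal G).det = G.edgeFinset.card * Real.log (1 - x ^ 2) := by
  set J := dartReversal G with hJ
  let φ := Fintype.equivFin V
  let ε : G.Dart → ℝ := fun a => if φ a.fst < φ a.snd then 1 else -1
  have hε : ∀ a : G.Dart, ε a.symm = -ε a := by
    intro a
    have hne : φ a.fst ≠ φ a.snd := fun h => a.fst_ne_snd (φ.injective h)
    rcases hne.lt_or_gt with h | h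
    · simp [ε, h, h.le]
    · simp [ε, h, h.not_gt]
  have hε2 : ∀ a, ε a * ε a = 1 := fun a => by simp only [ε]; split_ifs <;> norm_num
  have hP : Matrix.diagonal ε * Matrix.diagonal ε = 1 := by
    rw [Matrix.diagonal_mul_diagonal]; simp [hε2]
  -- Reversal flips the orientation sign `ε`, so conjugation by it sends `J` to `-J`. The
  -- determinant is thus known up to sign, which `Real.log` ignores.
  have hconj : Matrix.diagonal ε * (1 + x • J) * Matrix.diagonal ε = 1 - x • J := by
    ext a b
    rw [Matrix.mul_diagonal, Matrix.diagonal_mul]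
    simp only [Matrix.add_apply, Matrix.sub_apply, Matrix.smul_apply, hJ, dartReversal,
      Matrix.of_apply, Matrix.one_apply, smul_eq_mul]
    by_cases hab : a = b
    · subst hab
      have : a ≠ a.symm := a.symm_ne.symm
      simp [this, hε2]
    · by_cases hb : b = a.symm
      · have : ε a * x * ε a.symm = -x := by
          rw [hε]; linear_combination (-x) * hε2 a
        simp only [hb, if_true]
        rw [if_neg a.symm_ne.symm]
        simp [this]
      · simp [hab, hb]
  have hdet : (1 - x • J).det = (1 + x • J).det := by
    have h := congrArg Matrix.det hP
    rw [Matrix.det_mul, Matrix.det_one] at h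
    rw [← hconj, Matrix.det_mul, Matrix.det_mul, mul_right_comm, h, one_mul]
  have hsq : (1 + x • J).det ^ 2 = (1 - x ^ 2) ^ (2 * G.edgeFinset.card) := by
    have := one_add_smul_dartReversal_mul G x
    rw [← hJ] at this
    have h := congrArg Matrix.det this
    rw [Matrix.det_mul, hdet, Matrix.det_smul, Matrix.det_one, mul_one,
      G.dart_card_eq_twice_card_edges] at h
    rw [sq, h]
  have h := congrArg Real.log hsq
  rw [Real.log_pow, Real.log_pow] at h
  push_cast at h
  linarith

variable {G} in
theorem log_tau_sub_le {x : ℝ} (hΔ1 : 1 ≤ G.maxDegree) (h0 : 0 ≤ x) (h1 : x < 1)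
    (hΔ : ((G.maxDegree : ℝ) - 1) * x < 1) {m : ℕ} (hm : ((m : ℕ∞)) < G.egirth) :
    Real.log (tau G x) - G.edgeFinset.card * Real.log (1 - x ^ 2) ≤
      G.edgeFinset.card * (2 * ((((G.maxDegree : ℝ) - 1) * x) ^ (m + 1) /
        (1 - ((G.maxDegree : ℝ) - 1) * x))) := by
  have hx : 0 < 1 - x ^ 2 := by nlinarith
  have hb : (0 : ℝ) ≤ G.maxDegree - 1 := by
    have : (1 : ℝ) ≤ G.maxDegree := by exact_mod_cast hΔ1
    linarith
  have hK := treeConcentration_posDef G h0 h1 hΔ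
  have hu := (Matrix.isUnit_iff_isUnit_det _).1
    (isUnit_one_sub_smul hb h0 hΔ (sum_abs_nonbacktrackingMatrix_le (G := G)))
  have hne := hu.ne_zero
  rw [det_one_sub_smul_nonbacktrackingMatrix G hx.ne'] at hne
  have h2 := log_tau_le_neg_log_det_treeConcentration G h0 h1 hΔ
  have h3 := neg_log_det_one_sub_smul_le hb h0 hΔ
    (sum_abs_nonbacktrackingMatrix_le (G := G)) (m := m) fun k hk1 hkm =>
      trace_nonbacktrackingMatrix_pow hk1 (lt_of_le_of_lt (by exact_mod_cast hkm) hm)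
  rw [det_one_sub_smul_nonbacktrackingMatrix G hx.ne',
    Real.log_mul (left_ne_zero_of_mul hne) hK.det_pos.ne', log_det_one_add_smul_dartReversal,
    G.dart_card_eq_twice_card_edges] at h3
  push_cast at h3
  linarith

end IharaBass

/-! ### The girth estimate -/

variable {V : Type*} [Fintype V] [DecidableEq V] {G : SimpleGraph V} [DecidableRel G.Adj]

theorem abs_log_tau_div_sub_le {x : ℝ} (he : 0 < G.edgeFinset.card) (h0 : 0 ≤ x) (h1 : x < 1)
    (hΔ : ((G.maxDegree : ℝ) - 1) * x < 1) :
    |Real.log (tau G x) / (G.edgeFinset.card : ℝ) - Real.log (1 - x ^ 2)| ≤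
      2 * (girthPow (((G.maxDegree : ℝ) - 1) * x) G.egirth /
        (1 - ((G.maxDegree : ℝ) - 1) * x)) := by
  have he' : (0 : ℝ) < G.edgeFinset.card := by exact_mod_cast he
  have hΔ1 : 1 ≤ G.maxDegree := by
    by_contra hlt
    have hz : ∀ v, G.degree v = 0 := fun v => by
      have := G.degree_le_maxDegree v; omega
    have := G.sum_degrees_eq_twice_card_edges
    simp only [hz, sum_const_zero] at this
    omega
  set q := ((G.maxDegree : ℝ) - 1) * x with hq
  have hq0 : 0 ≤ q := by
    have : (1 : ℝ) ≤ G.maxDegree := by exact_mod_cast hΔ1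
    exact mul_nonneg (by linarith) h0
  have hq1 : 0 < 1 - q := by linarith
  have hdiv : Real.log (tau G x) / (G.edgeFinset.card : ℝ) - Real.log (1 - x ^ 2) =
      (Real.log (tau G x) - G.edgeFinset.card * Real.log (1 - x ^ 2)) / G.edgeFinset.card := by
    field_simp
  have hlow := card_mul_log_le_log_tau G h0 h1
  have hup : ∀ m : ℕ, (m : ℕ∞) < G.egirth →
      Real.log (tau G x) / (G.edgeFinset.card : ℝ) - Real.log (1 - x ^ 2) ≤
        2 * (q ^ (m + 1) / (1 - q)) := by
    intro m hm
    rw [hdiv, div_le_iff₀ he', mul_comm (2 * _)]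
    exact log_tau_sub_le hΔ1 h0 h1 hΔ hm
  rw [abs_of_nonneg (by rw [hdiv]; exact div_nonneg (by linarith) he'.le)]
  rw [girthPow]
  -- Without cycles every `m` is allowed and `m → ∞` gives `0`; for finite girth `g`, the choice `m
  -- = g - 1` gives the exponent `g`.
  split_ifs with hg
  · have hlim : Tendsto (fun m : ℕ => 2 * (q ^ (m + 1) / (1 - q))) atTop
        (𝓝 (2 * (0 / (1 - q)))) :=
      (((tendsto_pow_atTop_nhds_zero_of_lt_one hq0 (by linarith)).comp
        (tendsto_add_atTop_nat 1)).div_const _).const_mul 2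
    exact ge_of_tendsto' hlim fun m => hup m (by rw [hg]; exact ENat.natCast_lt_top m)
  · obtain ⟨g, hgg⟩ := ENat.ne_top_iff_exists.1 hg
    have h3 : 3 ≤ g := by
      have := G.three_le_egirth
      rw [← hgg] at this
      exact_mod_cast this
    have := hup (g - 1) (by rw [← hgg]; exact_mod_cast (by omega : g - 1 < g))
    rwa [Nat.sub_add_cancel (by omega), ← ENat.toNat_natCast g, hgg] at this

end GMRF

theorem theorem4 :
    (∀ (V : Type*) [Fintype V] [DecidableEq V] (G : SimpleGraph V) [DecidableRel G.Adj] (x : ℝ),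
      0 < G.edgeFinset.card → 0 ≤ x → x < 1 → ((G.maxDegree : ℝ) - 1) * x < 1 →
        |Real.log (GMRF.tau G x) / (G.edgeFinset.card : ℝ) - Real.log (1 - x ^ 2)| ≤
          2 * (GMRF.girthPow (((G.maxDegree : ℝ) - 1) * x) G.egirth /
            (1 - ((G.maxDegree : ℝ) - 1) * x))) ∧
    (∃ α : ℝ → ℝ → ℝ,
      (∀ d x : ℝ, 1 < d → 1 / (d - 1) < x → x < 1 → 0 < α d x) ∧
      ∀ (V : Type*) [Fintype V] [DecidableEq V] (G : SimpleGraph V) [DecidableRel G.Adj] (x : ℝ),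
        1 < GMRF.avgDegree G → 1 / (GMRF.avgDegree G - 1) < x → x < 1 →
          α (GMRF.avgDegree G) x ≤
            Real.log (GMRF.tau G x) / (G.edgeFinset.card : ℝ) - Real.log (1 - x ^ 2)) :=
  ⟨fun _ _ _ _ _ _ he h0 h1 hΔ => GMRF.abs_log_tau_div_sub_le he h0 h1 hΔ,
    GMRF.sidorenkoGap, fun _ _ hd hx hx1 => GMRF.sidorenkoGap_pos hd hx hx1,
    fun _ _ _ G _ _ hd hx hx1 => GMRF.sidorenkoGap_le G hd hx hx1⟩
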